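/- Let $\|x\|=(n^{-1}\sum_{i=1}^n x_i^2)^{1/2}$ be the normalized Euclidean norm on $\mathbb{R}^n$ and let $S^{n-1}=\{x\in\mathbb{R}^n:\|x\|=1\}$, with the distance $\|x-y\|$. (Equivalently, after dilating by $n^{-1/2}$, $S^{n-1}$ is the Euclidean unit sphere with the Euclidean distance.) A linear subsphere of $S^{n-1}$ of dimension $d$ is the intersection of $S^{n-1}$ with a $(d+1)$-dimensional linear subspace of $\mathbb{R}^n$; a great circle is a linear subsphere of dimension $1$; and for $A\subset S^{n-1}$ and $\epsilon>0$ the $\epsilon$-expansion $A_\epsilon$ is the set of points of $S^{n-1}$ at distance at most $\epsilon$ from $A$. For real $\lambda>1$ and an integer $k\ge 2$ put $s=\lambda^{1/2k}$, and let the staircase function $\varphi=\varphi_{\lambda,k}:\mathbb{R}\to\mathbb{R}$ be the strictly increasing continuous odd function such that, for every integer $m$, $$\varphi(s^{2mk-1})=s^{2mk+1},\qquad \varphi(s^{2mk+1})=s^{2(m+1)k-1},$$ and $\varphi$ is affine on the intervals $(s^{2mk-1},s^{2mk+1})$ and $(s^{2mk+1},s^{2(m+1)k-1})$. For $x\in\mathbb{R}^n$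 write $\varphi(x)=(\varphi(x_1),\dots,\varphi(x_n))$. **Theorem.** There are constants $\alpha\in(0,1)$, $\epsilon>0$, $\lambda>1$, $L$ and an integer $k\ge 2$ such that the following holds. For every $n$ the map $$\psi=\psi_n:S^{n-1}\to S^{n-1},\qquad \psi(x)=\frac{\varphi(x)}{\|\varphi(x)\|},$$ is well defined, continuous, satisfies $\psi(-x)=-\psi(x)$, and is a bijection that is $L$-Lipschitz with $L$-Lipschitz inverse. Moreover, if $X$ is the linear subsphere of $S^{n-1}$ of dimension $\lfloor\alpha n\rfloor$ cut out by a uniformly (rotation-invariantly) random $(\lfloor\alpha n\rfloor+1)$-dimensional subspace of $\mathbb{R}^n$, then, with probability $1-o(1)$ as $n\to\infty$, the set $\psi(X)_\epsilon$ contains no great circle. -/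

import Mathlib

open Filter Topology MeasureTheory
open scoped NNReal ENNReal

noncomputable section

/-- The unit sphere `S^{n-1}` of `ℝⁿ`, with the (chordal) distance inherited from `ℝⁿ`. -/
abbrev USphere (n : ℕ) : Type :=
  Metric.sphere (0 : EuclideanSpace ℝ (Fin n)) 1

/-- The linear subsphere of `S^{n-1}` cut out by a subspace `V` of `ℝⁿ`, that is, the unit sphere
of `V`. Its dimension is `dim V - 1`. -/
def linearSubsphere {n : ℕ} (V : Submodule ℝ (EuclideanSpace ℝ (Fin n))) : Set (USphere n) :=
  {x | (x : EuclideanSpace ℝ (Fin n)) ∈ V}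

/-- `A` contains a great circle, that is, the unit sphere of some 2-dimensional subspace. -/
def ContainsGreatCircle {n : ℕ} (A : Set (USphere n)) : Prop :=
  ∃ V : Submodule ℝ (EuclideanSpace ℝ (Fin n)), Module.finrank ℝ V = 2 ∧ linearSubsphere V ⊆ A

/-! ### The uniform random subspace -/

/-- The orthogonal group `O(n)`, with the topology of matrices. -/
abbrev OGroup (n : ℕ) : Type :=
  Matrix.orthogonalGroup (Fin n) ℝ

instance OGroup.compactSpace (n : ℕ) : CompactSpace (OGroup n) := by
  have hc : IsClosed ((Matrix.orthogonalGroup (Fin n) ℝ : Set (Matrix (Fin n) (Fin n) ℝ))) :=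
    isClosed_unitary
  refine isCompact_iff_compactSpace.mp (IsCompact.of_isClosed_subset
    (isCompact_univ_pi fun _ : Fin n => isCompact_univ_pi fun _ : Fin n =>
      isCompact_Icc (a := (-1 : ℝ)) (b := 1)) hc ?_)
  intro U hU i _ j _
  have h := entry_norm_bound_of_unitary hU i j
  rw [Real.norm_eq_abs] at h
  exact abs_le.mp h

instance OGroup.measurableSpace (n : ℕ) : MeasurableSpace (OGroup n) :=
  borel _

instance OGroup.borelSpace (n : ℕ) : BorelSpace (OGroup n) :=
  ⟨rfl⟩

/-- The Haar probability measure on `O(n)`: Haar measure with total mass one. -/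
def haarO (n : ℕ) : Measure (OGroup n) :=
  Measure.haarMeasure ⊤

/-- The span of the first `d` standard basis vectors of `ℝⁿ`. -/
def coordSubspace (n d : ℕ) : Submodule ℝ (EuclideanSpace ℝ (Fin n)) :=
  Submodule.span ℝ {v | ∃ i : Fin n, i.val < d ∧ v = EuclideanSpace.single i 1}

/-- The image of the span of the first `d` basis vectors under the orthogonal map `U`.
If `U` is Haar-distributed, this is the uniformly random `d`-dimensional subspace (`d ≤ n`). -/
def rotatedSubspace {n : ℕ} (d : ℕ) (U : OGroup n) : Submodule ℝ (EuclideanSpace ℝ (Fin n)) :=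
  (coordSubspace n d).map (Matrix.toEuclideanLin (U : Matrix (Fin n) (Fin n) ℝ))

/-- The probability that the uniformly random `d`-dimensional subspace of `ℝⁿ` has property `P`.
(For a property that is not measurable this is the outer probability.) -/
def randomSubspaceProb (n d : ℕ) (P : Submodule ℝ (EuclideanSpace ℝ (Fin n)) → Prop) : ℝ≥0∞ :=
  haarO n {U | P (rotatedSubspace d U)}

/-! ### The staircase function and the tennis ball map -/

/-- `φ` is the staircase function with parameters `lam` and `k`; here `s = lam ^ (1 / (2k))`.
For `lam > 1` and `k ≥ 2` there is exactly one such function. -/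
structure IsStaircase (lam : ℝ) (k : ℕ) (φ : ℝ → ℝ) : Prop where
  strictMono : StrictMono φ
  continuous : Continuous φ
  odd : ∀ x, φ (-x) = -φ x
  value_left : ∀ m : ℤ,
    φ ((lam ^ (1 / (2 * k) : ℝ)) ^ (2 * m * k - 1)) = (lam ^ (1 / (2 * k) : ℝ)) ^ (2 * m * k + 1)
  value_right : ∀ m : ℤ,
    φ ((lam ^ (1 / (2 * k) : ℝ)) ^ (2 * m * k + 1)) =
      (lam ^ (1 / (2 * k) : ℝ)) ^ (2 * (m + 1) * k - 1)
  affine_narrow : ∀ m : ℤ, ∃ a b : ℝ,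
    ∀ x ∈ Set.Ioo ((lam ^ (1 / (2 * k) : ℝ)) ^ (2 * m * k - 1))
      ((lam ^ (1 / (2 * k) : ℝ)) ^ (2 * m * k + 1)), φ x = a * x + b
  affine_wide : ∀ m : ℤ, ∃ a b : ℝ,
    ∀ x ∈ Set.Ioo ((lam ^ (1 / (2 * k) : ℝ)) ^ (2 * m * k + 1))
      ((lam ^ (1 / (2 * k) : ℝ)) ^ (2 * (m + 1) * k - 1)), φ x = a * x + b

/-- The vector `(φ(√n x₁), …, φ(√n xₙ))`. The factor `√n` turns a vector of Euclidean norm one into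
a vector of norm one for the normalized norm `(n⁻¹ ∑ xᵢ²)^(1/2)`. -/
def coordApply (φ : ℝ → ℝ) {n : ℕ} (x : EuclideanSpace ℝ (Fin n)) : EuclideanSpace ℝ (Fin n) :=
  WithLp.toLp 2 fun i => φ (Real.sqrt n * x i)

/-- `ψ` is the normalized coordinatewise version of `φ`: on the sphere of the normalized norm
`(n⁻¹ ∑ xᵢ²)^(1/2)` it is `x ↦ φ(x) / ‖φ(x)‖`, and here that sphere is identified with the Euclidean
unit sphere by the dilation `x ↦ √n x`. -/
def IsNormalizedCoordMap (φ : ℝ → ℝ) {n : ℕ} (ψ : USphere n → USphere n) : Prop :=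
  ∀ x : USphere n, coordApply φ (x : EuclideanSpace ℝ (Fin n)) ≠ 0 ∧
    (ψ x : EuclideanSpace ℝ (Fin n)) =
      ‖coordApply φ (x : EuclideanSpace ℝ (Fin n))‖⁻¹ •
        coordApply φ (x : EuclideanSpace ℝ (Fin n))

end

/-! Take `lam = 1000`. For large `k` the root `s = lam ^ (1 / (2k))` is close to 1, and `φ` is
almost constant, with value about `lam ^ (m + 1)`, on the wide interval from `lam ^ m * s` to `lam ^
(m + 1) / s`. Thus `φ` is close to the step function `stairRound`, and for a typical `x` the vector
`φ(x)` is close to one whose coordinates all lie in `{0} ∪ {± 1000 ^ m}`.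

No great circle stays near such vectors. If `u`, `v` are orthonormal in its plane, then `w = (3u +
4v) / 5` is also on the circle, so approximants `a`, `b`, `c` of multiples of `u`, `v`, `w` almost
satisfy `3a + 4b = 5c`. Yet in the sparse progression this equation has no nontrivial solution, even
approximately: `|3a + 4b - 5c| ≥ |a| / 2` in each coordinate (`half_abs_le_of_mem_geomSet`,
`not_forall_norm_smul_sub_le`).

It remains to make all points of a random subsphere typical at once. The distance from `φ(x)` to the
geometric vectors and the norm of `φ(x)` are Lipschitz in `x`, with a constant independent of `n`.
At a Gaussian vector they are controlled by sums of independent variables of quadratic growth, so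
Chernoff bounds give exponentially small failure probabilities. Rotation invariance transfers these
to one rotated unit vector, and a union bound over a net transfers them to the subsphere when `α` is
small (`exists_tendsto_haarO_rotatedSubspace`). Control of the norm lets the normalizing factor be
replaced by the constant `M √n`, where `M ^ 2` is the Gaussian mean of `φ ^ 2`. The parameter `k` is
fixed beforehand, by `L²` convergence of `φ` to `stairRound`.

The bi-Lipschitz property of `ψ` uses only that the slopes of `φ` lie between two positive constants
(`exists_isNormalizedCoordMap`). -/

noncomputable section

/-! ### Construction of the staircase function -/

/-- The union of the narrow intervals `± [s^(2mk-1), s^(2mk+1)]`. -/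
def narrowSet (s : ℝ) (k : ℕ) : Set ℝ :=
  ⋃ m : ℤ, {t | s ^ (2 * m * k - 1) ≤ |t| ∧ |t| ≤ s ^ (2 * m * k + 1)}

/-- The slope of the staircase function on the narrow intervals. -/
def narrowSlope (s : ℝ) (k : ℕ) : ℝ := (s ^ (2 * k - 1 : ℤ) - s) / (s - s⁻¹)

/-- The slope of the staircase function on the wide intervals. -/
def wideSlope (s : ℝ) (k : ℕ) : ℝ :=
  (s ^ (2 * k + 1 : ℤ) - s ^ (2 * k - 1 : ℤ)) / (s ^ (2 * k - 1 : ℤ) - s)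

open Classical in
/-- The derivative of the staircase function. -/
def stairSlope (s : ℝ) (k : ℕ) (t : ℝ) : ℝ :=
  if t ∈ narrowSet s k then narrowSlope s k else wideSlope s k

/-- The staircase function as the primitive of its slope. -/
def stair (s : ℝ) (k : ℕ) (x : ℝ) : ℝ := ∫ t in (0 : ℝ)..x, stairSlope s k t

section
variable {s : ℝ} {k : ℕ}

lemma measurableSet_narrowSet : MeasurableSet (narrowSet s k) := by
  refine MeasurableSet.iUnion fun m => ?_
  exact (measurableSet_le measurable_const measurable_id.abs).inter
    (measurableSet_le measurable_id.abs measurable_const)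

lemma measurable_stairSlope : Measurable (stairSlope s k) :=
  Measurable.ite measurableSet_narrowSet measurable_const measurable_const

lemma stairSlope_neg (t : ℝ) : stairSlope s k (-t) = stairSlope s k t := by
  have key : -t ∈ narrowSet s k ↔ t ∈ narrowSet s k := by simp [narrowSet]
  by_cases h : t ∈ narrowSet s k
  · simp only [stairSlope, h, key.2 h, if_true]
  · simp only [stairSlope, h, mt key.1 h, if_false]

/-- Multiplication by `s ^ (2mk) = lam ^ m` permutes the narrow intervals. This self-similarity
reduces all values at breakpoints to a single period. -/
lemma stairSlope_mul (hs : 1 < s) (m : ℤ) (t : ℝ) :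
    stairSlope s k (s ^ (2 * m * k) * t) = stairSlope s k t := by
  have h0 : 0 < s := by linarith
  have key : s ^ (2 * m * k) * t ∈ narrowSet s k ↔ t ∈ narrowSet s k := by
    have hc : 0 < s ^ (2 * m * k) := zpow_pos h0 _
    have e : ∀ j i : ℤ, s ^ (2 * j * k + i) = s ^ (2 * m * k) * s ^ (2 * (j - m) * k + i) := by
      intro j i
      rw [← zpow_add₀ h0.ne']
      congr 1; ring
    simp only [narrowSet, Set.mem_iUnion, Set.mem_ofPred_eq, abs_mul, abs_of_pos hc]
    constructor
    · rintro ⟨j, h1, h2⟩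
      refine ⟨j - m, ?_, ?_⟩
      · rw [sub_eq_add_neg, e] at h1
        exact le_of_mul_le_mul_left h1 hc
      · rw [e] at h2
        exact le_of_mul_le_mul_left h2 hc
    · rintro ⟨j, h1, h2⟩
      refine ⟨j + m, ?_, ?_⟩
      · rw [sub_eq_add_neg, e, add_sub_cancel_right]
        exact mul_le_mul_of_nonneg_left h1 hc.le
      · rw [e, add_sub_cancel_right]
        exact mul_le_mul_of_nonneg_left h2 hc.le
  by_cases h : t ∈ narrowSet s k
  · simp only [stairSlope, h, key.2 h, if_true]
  · simp only [stairSlope, h, mt key.1 h, if_false]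

lemma stairSlope_of_narrow (hs : 1 < s) {m : ℤ} {t : ℝ} (h1 : s ^ (2 * m * k - 1) < t)
    (h2 : t < s ^ (2 * m * k + 1)) : stairSlope s k t = narrowSlope s k := by
  have h0 : 0 < t := (zpow_pos (by linarith) _).trans h1
  have : t ∈ narrowSet s k :=
    Set.mem_iUnion.2 ⟨m, by rw [Set.mem_ofPred_eq, abs_of_pos h0]; exact ⟨h1.le, h2.le⟩⟩
  simp [stairSlope, this]

lemma stairSlope_of_wide (hs : 1 < s) (hk : 2 ≤ k) {m : ℤ} {t : ℝ} (h1 : s ^ (2 * m * k + 1) < t)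
    (h2 : t < s ^ (2 * (m + 1) * k - 1)) : stairSlope s k t = wideSlope s k := by
  have h0 : 0 < t := (zpow_pos (by linarith) _).trans h1
  have : t ∉ narrowSet s k := by
    intro h
    obtain ⟨j, h3, h4⟩ := Set.mem_iUnion.1 h
    rw [abs_of_pos h0] at h3 h4
    have a1 := (zpow_lt_zpow_iff_right₀ hs).1 (h1.trans_le h4)
    have a2 := (zpow_lt_zpow_iff_right₀ hs).1 (h3.trans_lt h2)
    have a3 : m < j := by
      by_contra! hle
      have : (j : ℤ) * k ≤ m * k := mul_le_mul_of_nonneg_right hle (by positivity)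
      linarith
    have : (m + 1 : ℤ) * k ≤ j * k := mul_le_mul_of_nonneg_right a3 (by positivity)
    linarith
  simp [stairSlope, this]

lemma narrowSlope_pos (hs : 1 < s) (hk : 2 ≤ k) : 0 < narrowSlope s k := by
  have h1 : s ^ (1 : ℤ) < s ^ (2 * k - 1 : ℤ) := zpow_lt_zpow_right₀ hs (by omega)
  rw [zpow_one] at h1
  have h2 : s⁻¹ < 1 := inv_lt_one_of_one_lt₀ hs
  exact div_pos (by linarith) (by linarith)

lemma wideSlope_pos (hs : 1 < s) (hk : 2 ≤ k) : 0 < wideSlope s k := by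
  have h1 : s ^ (1 : ℤ) < s ^ (2 * k - 1 : ℤ) := zpow_lt_zpow_right₀ hs (by omega)
  have h2 : s ^ (2 * k - 1 : ℤ) < s ^ (2 * k + 1 : ℤ) := zpow_lt_zpow_right₀ hs (by omega)
  rw [zpow_one] at h1
  exact div_pos (by linarith) (by linarith)

lemma min_le_stairSlope (t : ℝ) : min (narrowSlope s k) (wideSlope s k) ≤ stairSlope s k t := by
  unfold stairSlope; split_ifs <;> simp

lemma stairSlope_le_max (t : ℝ) : stairSlope s k t ≤ max (narrowSlope s k) (wideSlope s k) := by
  unfold stairSlope; split_ifs <;> simp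

/-- The breakpoints accumulate at 0, but the slope takes only two values; hence the primitive based
at 0 exists. -/
lemma intervalIntegrable_stairSlope (a b : ℝ) :
    IntervalIntegrable (stairSlope s k) volume a b := by
  have h : IntervalIntegrable (fun _ : ℝ => |narrowSlope s k| + |wideSlope s k|) volume a b :=
    intervalIntegrable_const
  refine h.mono_fun measurable_stairSlope.aestronglyMeasurable (ae_of_all _ fun t => ?_)
  have : 0 ≤ |narrowSlope s k| := abs_nonneg _
  have : 0 ≤ |wideSlope s k| := abs_nonneg _
  change |stairSlope s k t| ≤ |_|
  rw [abs_of_nonneg (a := |narrowSlope s k| + |wideSlope s k|) (by positivity)]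
  unfold stairSlope; split_ifs <;> linarith

lemma stair_sub (x y : ℝ) : stair s k y - stair s k x = ∫ t in x..y, stairSlope s k t :=
  intervalIntegral.integral_interval_sub_left (intervalIntegrable_stairSlope _ _)
    (intervalIntegrable_stairSlope _ _)

lemma le_stair_sub {x y : ℝ} (h : x ≤ y) :
    min (narrowSlope s k) (wideSlope s k) * (y - x) ≤ stair s k y - stair s k x := by
  rw [stair_sub, mul_comm, ← smul_eq_mul, ← intervalIntegral.integral_const]
  exact intervalIntegral.integral_mono_on h intervalIntegrable_const
    (intervalIntegrable_stairSlope _ _) fun t _ => min_le_stairSlope t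

lemma stair_sub_le {x y : ℝ} (h : x ≤ y) :
    stair s k y - stair s k x ≤ max (narrowSlope s k) (wideSlope s k) * (y - x) := by
  rw [stair_sub, mul_comm, ← smul_eq_mul, ← intervalIntegral.integral_const]
  exact intervalIntegral.integral_mono_on h (intervalIntegrable_stairSlope _ _)
    intervalIntegrable_const fun t _ => stairSlope_le_max t

lemma stair_neg (x : ℝ) : stair s k (-x) = -stair s k x := by
  have h := intervalIntegral.integral_comp_neg (a := 0) (b := x) (stairSlope s k)
  simp only [stairSlope_neg, neg_zero] at h
  rw [stair, stair, h, intervalIntegral.integral_symm]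

lemma stair_mul (hs : 1 < s) (m : ℤ) (x : ℝ) :
    stair s k (s ^ (2 * m * k) * x) = s ^ (2 * m * k) * stair s k x := by
  have hc : s ^ (2 * m * k) ≠ 0 := (zpow_pos (by linarith) _).ne'
  have h := intervalIntegral.integral_comp_mul_left (a := 0) (b := x) (stairSlope s k) hc
  simp only [stairSlope_mul hs, mul_zero, smul_eq_mul] at h
  rw [stair, stair, h, mul_inv_cancel_left₀ hc]

lemma stair_sub_of_slope {a b c x y : ℝ} (h : ∀ t ∈ Set.Ioo a b, stairSlope s k t = c)
    (hx : x ∈ Set.Icc a b) (hy : y ∈ Set.Icc a b) : stair s k y - stair s k x = c * (y - x) := by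
  have key : ∀ x ∈ Set.Icc a b, ∀ y ∈ Set.Icc a b, x ≤ y →
      stair s k y - stair s k x = c * (y - x) := by
    intro x hx y hy hxy
    rw [stair_sub, mul_comm, ← smul_eq_mul, ← intervalIntegral.integral_const,
      intervalIntegral.integral_of_le hxy, intervalIntegral.integral_of_le hxy,
      integral_Ioc_eq_integral_Ioo, integral_Ioc_eq_integral_Ioo]
    exact setIntegral_congr_fun measurableSet_Ioo fun t ht =>
      h t ⟨hx.1.trans_lt ht.1, ht.2.trans_le hy.2⟩
  rcases le_total x y with hxy | hxy
  · exact key x hx y hy hxy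
  · have := key y hy x hx hxy
    linarith

/-- The slopes fix only increments. Over one period, from `s⁻¹` to `lam * s⁻¹`, the increment is
`(lam - 1) * s`, while by homogeneity it is `(lam - 1)` times the value at `s⁻¹`; this determines
the value. -/
lemma stair_inv (hs : 1 < s) (hk : 2 ≤ k) : stair s k s⁻¹ = s := by
  have h0 : 0 < s := by linarith
  have h1 : s < s ^ (2 * k - 1 : ℤ) := by
    simpa using zpow_lt_zpow_right₀ hs (show (1 : ℤ) < 2 * k - 1 by omega)
  have h2 : s⁻¹ < s := (inv_lt_one_of_one_lt₀ hs).trans hs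
  have e1 : stair s k s - stair s k s⁻¹ = narrowSlope s k * (s - s⁻¹) := by
    refine stair_sub_of_slope (a := s⁻¹) (b := s) (fun t ht => ?_) ⟨le_rfl, h2.le⟩ ⟨h2.le, le_rfl⟩
    exact stairSlope_of_narrow hs (m := 0) (by simpa using ht.1) (by simpa using ht.2)
  have e2 : stair s k (s ^ (2 * k - 1 : ℤ)) - stair s k s
      = wideSlope s k * (s ^ (2 * k - 1 : ℤ) - s) := by
    refine stair_sub_of_slope (a := s) (b := s ^ (2 * k - 1 : ℤ)) (fun t ht => ?_)
      ⟨le_rfl, h1.le⟩ ⟨h1.le, le_rfl⟩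
    exact stairSlope_of_wide hs hk (m := 0) (by simpa using ht.1) (by simpa using ht.2)
  have e3 : stair s k (s ^ (2 * k - 1 : ℤ)) = s ^ (2 * k : ℤ) * stair s k s⁻¹ := by
    have := stair_mul (k := k) hs 1 s⁻¹
    rwa [mul_one, ← zpow_sub_one₀ h0.ne'] at this
  rw [narrowSlope, div_mul_cancel₀ _ (by linarith)] at e1
  rw [wideSlope, div_mul_cancel₀ _ (by linarith)] at e2
  have h3 : 1 < s ^ (2 * k : ℤ) := by
    simpa using zpow_lt_zpow_right₀ hs (show (0 : ℤ) < 2 * k by omega)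
  have e4 : s ^ (2 * k + 1 : ℤ) = s ^ (2 * k : ℤ) * s := zpow_add_one₀ h0.ne' _
  have : (s ^ (2 * k : ℤ) - 1) * (stair s k s⁻¹ - s) = 0 := by
    linear_combination e1 + e2 - e3 + e4
  rcases mul_eq_zero.1 this with h | h <;> linarith

lemma stair_value_left (hs : 1 < s) (hk : 2 ≤ k) (m : ℤ) :
    stair s k (s ^ (2 * m * k - 1)) = s ^ (2 * m * k + 1) := by
  have h0 : s ≠ 0 := by linarith
  rw [zpow_sub_one₀ h0, stair_mul hs, stair_inv hs hk, zpow_add_one₀ h0]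

lemma stair_value_right (hs : 1 < s) (hk : 2 ≤ k) (m : ℤ) :
    stair s k (s ^ (2 * m * k + 1)) = s ^ (2 * (m + 1) * k - 1) := by
  have h0 : s ≠ 0 := by linarith
  have h2 : s⁻¹ < s := (inv_lt_one_of_one_lt₀ hs).trans hs
  have e1 : stair s k s - stair s k s⁻¹ = narrowSlope s k * (s - s⁻¹) := by
    refine stair_sub_of_slope (a := s⁻¹) (b := s) (fun t ht => ?_) ⟨le_rfl, h2.le⟩ ⟨h2.le, le_rfl⟩
    exact stairSlope_of_narrow hs (m := 0) (by simpa using ht.1) (by simpa using ht.2)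
  rw [narrowSlope, div_mul_cancel₀ _ (by linarith), stair_inv hs hk] at e1
  have e2 : stair s k s = s ^ (2 * k - 1 : ℤ) := by linarith
  rw [zpow_add_one₀ h0, stair_mul hs, e2, ← zpow_add₀ h0]
  congr 1; ring

end

/-- Existence of the staircase function, together with bounds on its slopes. -/
theorem exists_isStaircase {lam : ℝ} (hlam : 1 < lam) {k : ℕ} (hk : 2 ≤ k) :
    ∃ φ : ℝ → ℝ, IsStaircase lam k φ ∧ ∃ a b : ℝ, 0 < a ∧ 0 < b ∧
      ∀ x y, x ≤ y → a * (y - x) ≤ φ y - φ x ∧ φ y - φ x ≤ b * (y - x) := by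
  set s := lam ^ (1 / (2 * k) : ℝ) with hs_def
  have hs : 1 < s := Real.one_lt_rpow hlam (by positivity)
  have ha : 0 < min (narrowSlope s k) (wideSlope s k) :=
    lt_min (narrowSlope_pos hs hk) (wideSlope_pos hs hk)
  have hb : 0 < max (narrowSlope s k) (wideSlope s k) := lt_max_of_lt_left (narrowSlope_pos hs hk)
  have affine : ∀ a b c : ℝ, (∀ t ∈ Set.Ioo a b, stairSlope s k t = c) →
      ∃ a' b' : ℝ, ∀ x ∈ Set.Ioo a b, stair s k x = a' * x + b' := by
    intro a b c h
    refine ⟨c, stair s k a - c * a, fun x hx => ?_⟩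
    have hab := (hx.1.trans hx.2).le
    have := stair_sub_of_slope h ⟨le_rfl, hab⟩ (Set.Ioo_subset_Icc_self hx)
    linarith
  refine ⟨stair s k, ⟨?_, ?_, stair_neg, ?_, ?_, ?_, ?_⟩, _, _, ha, hb,
    fun x y h => ⟨le_stair_sub h, stair_sub_le h⟩⟩
  · intro x y h
    have := le_stair_sub (s := s) (k := k) h.le
    have := mul_pos ha (sub_pos.2 h)
    linarith
  · exact intervalIntegral.continuous_primitive (fun a b => intervalIntegrable_stairSlope a b) 0
  · rw [← hs_def]; exact stair_value_left hs hk
  · rw [← hs_def]; exact stair_value_right hs hk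
  · rw [← hs_def]; exact fun m => affine _ _ _ fun t ht => stairSlope_of_narrow hs ht.1 ht.2
  · rw [← hs_def]; exact fun m => affine _ _ _ fun t ht => stairSlope_of_wide hs hk ht.1 ht.2

/-! ### Size and rounding of the staircase function -/

/-- The rounding to `± lam ^ (m + 1)` of the numbers with `lam ^ m ≤ |t| < lam ^ (m + 1)`. -/
def stairRound (lam t : ℝ) : ℝ := Real.sign t * lam ^ (⌊Real.logb lam |t|⌋ + 1)

/-- The set `{0} ∪ {± lam ^ m}`. -/
def geomSet (lam : ℝ) : Set ℝ := {t | t = 0 ∨ ∃ m : ℤ, |t| = lam ^ m}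

lemma stairRound_mem_geomSet {lam : ℝ} (hlam : 1 < lam) (t : ℝ) :
    stairRound lam t ∈ geomSet lam := by
  have h (m : ℤ) : 0 < lam ^ m := zpow_pos (by linarith) _
  rcases Real.sign_apply_eq t with h1 | h1 | h1
  · exact Or.inr ⟨⌊Real.logb lam |t|⌋ + 1, by
      rw [stairRound, h1, abs_mul, abs_of_pos (h _)]; simp⟩
  · exact Or.inl (by simp [stairRound, h1])
  · exact Or.inr ⟨⌊Real.logb lam |t|⌋ + 1, by
      rw [stairRound, h1, abs_mul, abs_of_pos (h _)]; simp⟩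

lemma stairRound_neg (lam t : ℝ) : stairRound lam (-t) = -stairRound lam t := by
  simp [stairRound, Real.sign_neg]

lemma stairRound_zero (lam : ℝ) : stairRound lam 0 = 0 := by simp [stairRound]

lemma measurable_stairRound (lam : ℝ) : Measurable (stairRound lam) := by
  have h1 : Measurable Real.sign := by
    unfold Real.sign
    exact Measurable.ite measurableSet_Iio measurable_const
      (Measurable.ite measurableSet_Ioi measurable_const measurable_const)
  have h2 : Measurable fun t : ℝ => ⌊Real.logb lam |t|⌋ := by
    unfold Real.logb
    exact Int.measurable_floor.comp ((Real.measurable_log.comp measurable_id.abs).div_const _)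
  exact h1.mul ((measurable_from_top (f := fun m : ℤ => lam ^ (m + 1))).comp h2)

lemma floor_logb_bounds {lam x : ℝ} (hlam : 1 < lam) (hx : 0 < x) :
    lam ^ ⌊Real.logb lam x⌋ ≤ x ∧ x < lam ^ (⌊Real.logb lam x⌋ + 1) := by
  constructor
  · rw [← Real.rpow_intCast, ← Real.le_logb_iff_rpow_le hlam hx]
    exact Int.floor_le _
  · rw [← Real.rpow_intCast, ← Real.logb_lt_iff_lt_rpow hlam hx]
    push_cast
    exact Int.lt_floor_add_one _

lemma stairRound_of_pos {lam x : ℝ} (hx : 0 < x) :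
    stairRound lam x = lam ^ (⌊Real.logb lam x⌋ + 1) := by
  rw [stairRound, Real.sign_of_pos hx, abs_of_pos hx, one_mul]

namespace IsStaircase
variable {lam : ℝ} {k : ℕ} {φ : ℝ → ℝ}

lemma map_zero (h : IsStaircase lam k φ) : φ 0 = 0 := by
  have := h.odd 0
  rw [neg_zero] at this
  linarith

lemma one_lt_root (hlam : 1 < lam) (hk : 2 ≤ k) : 1 < lam ^ (1 / (2 * k) : ℝ) :=
  Real.one_lt_rpow hlam (by positivity)

lemma root_zpow (hlam : 1 < lam) (hk : 2 ≤ k) (m : ℤ) :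
    (lam ^ (1 / (2 * k) : ℝ)) ^ (2 * m * k) = lam ^ m := by
  rw [← Real.rpow_intCast, ← Real.rpow_mul (by linarith), ← Real.rpow_intCast]
  congr 1
  have : (k : ℝ) ≠ 0 := by positivity
  push_cast
  field_simp

lemma value_div (h : IsStaircase lam k φ) (hlam : 1 < lam) (hk : 2 ≤ k) (m : ℤ) :
    φ (lam ^ m / lam ^ (1 / (2 * k) : ℝ)) = lam ^ m * lam ^ (1 / (2 * k) : ℝ) := by
  have h0 : lam ^ (1 / (2 * k) : ℝ) ≠ 0 := by linarith [one_lt_root hlam hk]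
  have := h.value_left m
  rwa [zpow_sub_one₀ h0, zpow_add_one₀ h0, root_zpow hlam hk, ← div_eq_mul_inv] at this

lemma value_mul (h : IsStaircase lam k φ) (hlam : 1 < lam) (hk : 2 ≤ k) (m : ℤ) :
    φ (lam ^ m * lam ^ (1 / (2 * k) : ℝ)) = lam ^ (m + 1) / lam ^ (1 / (2 * k) : ℝ) := by
  have h0 : lam ^ (1 / (2 * k) : ℝ) ≠ 0 := by linarith [one_lt_root hlam hk]
  have := h.value_right m
  rwa [zpow_sub_one₀ h0, zpow_add_one₀ h0, root_zpow hlam hk, root_zpow hlam hk,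
    ← div_eq_mul_inv] at this

lemma div_le_apply (h : IsStaircase lam k φ) (hlam : 1 < lam) (hk : 2 ≤ k) {x : ℝ} (hx : 0 < x) :
    x / lam ≤ φ x := by
  have h0 : 0 < lam := by linarith
  have hs := one_lt_root hlam hk
  obtain ⟨h1, h2⟩ := floor_logb_bounds hlam hx
  set m := ⌊Real.logb lam x⌋
  have hm : 0 < lam ^ m := zpow_pos h0 _
  rw [zpow_add_one₀ h0.ne'] at h2
  calc x / lam ≤ lam ^ m := by rw [div_le_iff₀ h0]; exact h2.le
    _ ≤ lam ^ m * lam ^ (1 / (2 * k) : ℝ) := le_mul_of_one_le_right hm.le hs.le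
    _ = φ (lam ^ m / lam ^ (1 / (2 * k) : ℝ)) := (h.value_div hlam hk m).symm
    _ ≤ φ x := h.strictMono.monotone ((div_le_self hm.le hs.le).trans h1)

lemma apply_le_mul (h : IsStaircase lam k φ) (hlam : 1 < lam) (hk : 2 ≤ k) {x : ℝ} (hx : 0 < x) :
    φ x ≤ lam ^ 2 * x := by
  have h0 : 0 < lam := by linarith
  have hs := one_lt_root hlam hk
  obtain ⟨h1, h2⟩ := floor_logb_bounds hlam hx
  set m := ⌊Real.logb lam x⌋
  have hm : 0 < lam ^ (m + 1) := zpow_pos h0 _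
  calc φ x ≤ φ (lam ^ (m + 1) * lam ^ (1 / (2 * k) : ℝ)) :=
        h.strictMono.monotone (h2.le.trans (le_mul_of_one_le_right hm.le hs.le))
    _ = lam ^ (m + 1 + 1) / lam ^ (1 / (2 * k) : ℝ) := h.value_mul hlam hk _
    _ ≤ lam ^ (m + 1 + 1) := div_le_self (zpow_pos h0 _).le hs.le
    _ = lam ^ 2 * lam ^ m := by rw [zpow_add_one₀ h0.ne', zpow_add_one₀ h0.ne']; ring
    _ ≤ lam ^ 2 * x := by gcongr

lemma div_le_abs_apply (h : IsStaircase lam k φ) (hlam : 1 < lam) (hk : 2 ≤ k) (x : ℝ) :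
    |x| / lam ≤ |φ x| := by
  rcases lt_trichotomy x 0 with hx | hx | hx
  · have := h.div_le_apply hlam hk (neg_pos.2 hx)
    rw [h.odd] at this
    rw [abs_of_neg hx]
    exact this.trans (neg_le_abs _)
  · simp [hx]
  · rw [abs_of_pos hx]
    exact (h.div_le_apply hlam hk hx).trans (le_abs_self _)

lemma abs_apply_le (h : IsStaircase lam k φ) (hlam : 1 < lam) (hk : 2 ≤ k) (x : ℝ) :
    |φ x| ≤ lam ^ 2 * |x| := by
  rcases lt_trichotomy x 0 with hx | hx | hx
  · have h1 := h.apply_le_mul hlam hk (neg_pos.2 hx)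
    have h2 := h.strictMono hx
    rw [h.odd] at h1
    rw [h.map_zero] at h2
    rwa [abs_of_neg hx, abs_of_neg h2]
  · simp [hx, h.map_zero]
  · have h2 := h.strictMono hx
    rw [h.map_zero] at h2
    rw [abs_of_pos hx, abs_of_pos h2]
    exact h.apply_le_mul hlam hk hx

/-- For `x > 0` both `φ x` and the rounding lie in `(0, lam ^ 2 * x]`. The bound does not involve
`k`, so it serves for dominated convergence as `k → ∞`. -/
lemma abs_sub_stairRound_le (h : IsStaircase lam k φ) (hlam : 1 < lam) (hk : 2 ≤ k) (x : ℝ) :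
    |φ x - stairRound lam x| ≤ lam ^ 2 * |x| := by
  have key : ∀ x, 0 < x → |φ x - stairRound lam x| ≤ lam ^ 2 * |x| := by
    intro x hx
    have h0 : 0 < lam := by linarith
    have h1 := h.apply_le_mul hlam hk hx
    have h2 := h.strictMono hx
    rw [h.map_zero] at h2
    rw [abs_of_pos hx, stairRound_of_pos hx, zpow_add_one₀ h0.ne']
    have h3 := (floor_logb_bounds hlam hx).1
    have h4 : 0 < lam ^ ⌊Real.logb lam x⌋ := zpow_pos h0 _
    rw [abs_le]
    have : lam ^ ⌊Real.logb lam x⌋ * lam ≤ lam ^ 2 * x := by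
      calc _ ≤ x * lam := by gcongr
        _ ≤ x * lam * lam := le_mul_of_one_le_right (by positivity) hlam.le
        _ = _ := by ring
    have := mul_pos h4 h0
    constructor <;> linarith
  rcases lt_trichotomy x 0 with hx | hx | hx
  · have := key _ (neg_pos.2 hx)
    rwa [h.odd, stairRound_neg, abs_neg, ← neg_sub', abs_neg] at this
  · simp [hx, h.map_zero, stairRound_zero]
  · exact key x hx

/-- On a whole wide interval `φ` only climbs from `lam ^ (m + 1) / s` to `lam ^ (m + 1) * s`. -/
lemma abs_sub_zpow_le (h : IsStaircase lam k φ) (hlam : 1 < lam) (hk : 2 ≤ k) {m : ℤ} {x : ℝ}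
    (h1 : lam ^ m * lam ^ (1 / (2 * k) : ℝ) ≤ x)
    (h2 : x ≤ lam ^ (m + 1) / lam ^ (1 / (2 * k) : ℝ)) :
    |φ x - lam ^ (m + 1)| ≤
      lam ^ (m + 1) * (lam ^ (1 / (2 * k) : ℝ) - (lam ^ (1 / (2 * k) : ℝ))⁻¹) := by
  have hs := one_lt_root hlam hk
  set s := lam ^ (1 / (2 * k) : ℝ)
  have hm : 0 < lam ^ (m + 1) := zpow_pos (by linarith) _
  have e1 := h.strictMono.monotone h1
  have e2 := h.strictMono.monotone h2
  rw [h.value_mul hlam hk, div_eq_mul_inv] at e1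
  rw [h.value_div hlam hk] at e2
  have h3 : s⁻¹ < 1 := inv_lt_one_of_one_lt₀ hs
  rw [abs_le]
  constructor <;> nlinarith

end IsStaircase

lemma tendsto_rpow_one_div_two_mul {lam : ℝ} (hlam : 1 < lam) :
    Tendsto (fun k : ℕ => lam ^ (1 / (2 * k) : ℝ)) atTop (𝓝 1) := by
  have h1 : Tendsto (fun k : ℕ => (1 / (2 * k) : ℝ)) atTop (𝓝 0) := by
    have := tendsto_one_div_atTop_nhds_zero_nat (𝕜 := ℝ)
    simpa [mul_comm] using this.mul_const 2⁻¹
  have := (Real.continuous_const_rpow (by linarith : lam ≠ 0)).tendsto 0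
  rw [Real.rpow_zero] at this
  exact this.comp h1

/-- Since `s → 1`, the wide intervals exhaust the gaps between consecutive powers of `lam`, while
the oscillation of `φ` on each of them tends to 0. -/
lemma tendsto_staircase_sub_stairRound {lam : ℝ} (hlam : 1 < lam) {φ : ℕ → ℝ → ℝ}
    (hφ : ∀ k, 2 ≤ k → IsStaircase lam k (φ k)) {t : ℝ} (ht : t ∉ geomSet lam) :
    Tendsto (fun k => φ k t - stairRound lam t) atTop (𝓝 0) := by
  have h0 : 0 < lam := by linarith
  have key : ∀ t, t ∉ geomSet lam → 0 < t →
      Tendsto (fun k => φ k t - stairRound lam t) atTop (𝓝 0) := by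
    intro t ht htpos
    have hroot := tendsto_rpow_one_div_two_mul hlam
    obtain ⟨h1, h2⟩ := floor_logb_bounds hlam htpos
    rw [stairRound_of_pos htpos]
    set m := ⌊Real.logb lam t⌋
    have h3 : lam ^ m < t := lt_of_le_of_ne h1 fun h =>
      ht (Or.inr ⟨m, by rw [abs_of_pos htpos, h]⟩)
    have e1 : ∀ᶠ k : ℕ in atTop, lam ^ m * lam ^ (1 / (2 * k) : ℝ) < t := by
      refine (hroot.const_mul (lam ^ m)).eventually_lt_const ?_
      rwa [mul_one]
    have e2 : ∀ᶠ k : ℕ in atTop, t < lam ^ (m + 1) / lam ^ (1 / (2 * k) : ℝ) := by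
      refine (tendsto_const_nhds.div hroot one_ne_zero).eventually_const_lt ?_
      rwa [div_one]
    rw [tendsto_zero_iff_abs_tendsto_zero]
    refine squeeze_zero' (Eventually.of_forall fun k => abs_nonneg _)
      (g := fun k : ℕ => lam ^ (m + 1) *
        (lam ^ (1 / (2 * k) : ℝ) - (lam ^ (1 / (2 * k) : ℝ))⁻¹)) ?_ ?_
    · filter_upwards [e1, e2, eventually_ge_atTop 2] with k a1 a2 hk
      exact (hφ k hk).abs_sub_zpow_le hlam hk a1.le a2.le
    · have := (hroot.sub (hroot.inv₀ one_ne_zero)).const_mul (lam ^ (m + 1))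
      simpa using this
  rcases lt_trichotomy t 0 with h | h | h
  · have h1 : -t ∉ geomSet lam := by simpa [geomSet] using ht
    have := (key _ h1 (neg_pos.2 h)).neg
    rw [neg_zero] at this
    refine this.congr' ?_
    filter_upwards [eventually_ge_atTop 2] with k hk
    rw [(hφ k hk).odd, stairRound_neg]
    ring
  · exact absurd (Or.inl h) ht
  · exact key t ht h

open ProbabilityTheory in
lemma tendsto_integral_staircase_sub_stairRound_sq {lam : ℝ} (hlam : 1 < lam) {φ : ℕ → ℝ → ℝ}
    (hφ : ∀ k, 2 ≤ k → IsStaircase lam k (φ k)) :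
    Tendsto (fun k => ∫ t, (φ k t - stairRound lam t) ^ 2 ∂gaussianReal 0 1) atTop (𝓝 0) := by
  -- Pointwise convergence may fail only at the jumps of the rounding, a countable set and hence
  -- null for the Gaussian measure.
  have hnull : ∀ᵐ t ∂gaussianReal 0 1, t ∉ geomSet lam := by
    have hc : (geomSet lam).Countable := by
      have : geomSet lam ⊆ {0} ∪ ((Set.range fun m : ℤ => lam ^ m) ∪
          Set.range fun m : ℤ => -lam ^ m) := by
        rintro t (h | ⟨m, h⟩)
        · exact Or.inl h
        · rcases abs_eq (zpow_nonneg (by linarith) m) |>.1 h with h | h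
          · exact Or.inr (Or.inl ⟨m, h.symm⟩)
          · exact Or.inr (Or.inr ⟨m, h.symm⟩)
      exact ((Set.countable_singleton 0).union
        ((Set.countable_range _).union (Set.countable_range _))).mono this
    have := nullSingletonClass_gaussianReal (μ := 0) (v := 1) one_ne_zero
    exact hc.ae_notMem _
  have hint : Integrable (fun t : ℝ => (lam ^ 2 * |t|) ^ 2) (gaussianReal 0 1) := by
    have h := (memLp_id_gaussianReal (μ := 0) (v := 1) 2).integrable_sq
    simpa [mul_pow] using h.const_mul ((lam ^ 2) ^ 2)
  have := tendsto_integral_filter_of_dominated_convergence (μ := gaussianReal 0 1)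
    (F := fun k t => (φ k t - stairRound lam t) ^ 2) (f := fun _ => 0) (l := atTop) _ ?_ ?_ hint ?_
  · simpa using this
  · filter_upwards [eventually_ge_atTop 2] with k hk
    exact (((hφ k hk).continuous.measurable.sub (measurable_stairRound lam)).pow_const
      2).aestronglyMeasurable
  · filter_upwards [eventually_ge_atTop 2] with k hk
    refine ae_of_all _ fun t => ?_
    rw [Real.norm_of_nonneg (sq_nonneg _), ← sq_abs]
    exact pow_le_pow_left₀ (abs_nonneg _) ((hφ k hk).abs_sub_stairRound_le hlam hk t) 2
  · filter_upwards [hnull] with t ht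
    simpa using (tendsto_staircase_sub_stairRound hlam hφ ht).pow 2

/-! ### Chernoff bounds for sums of functions of quadratic growth of Gaussian variables -/

section Chernoff
open ProbabilityTheory

/-- At `t = 0` both sides equal 1, and their derivatives are the mean of `f` and `m`; the strict
inequality of derivatives persists for some small `t > 0`. -/
lemma exists_mgf_lt_exp {Ω : Type*} [MeasurableSpace Ω] {μ : Measure Ω} [IsProbabilityMeasure μ]
    {f : Ω → ℝ} (h0 : 0 ∈ interior (integrableExpSet f μ)) {m : ℝ} (hm : ∫ x, f x ∂μ < m) :
    ∃ t, 0 < t ∧ t ∈ integrableExpSet f μ ∧ mgf f μ t < Real.exp (t * m) := by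
  have h1 : HasDerivAt (fun t => mgf f μ t - Real.exp (t * m)) ((∫ x, f x ∂μ) - m) 0 := by
    have e1 := hasDerivAt_mgf h0
    have e2 : HasDerivAt (fun t => Real.exp (t * m)) m 0 := by
      simpa using ((hasDerivAt_id (0 : ℝ)).mul_const m).exp
    simpa using! e1.sub e2
  have h2 := (hasDerivAt_iff_tendsto_slope.1 h1).eventually_lt_const (sub_neg.2 hm)
  have h3 : ∀ᶠ t in 𝓝[>] (0 : ℝ), slope (fun t => mgf f μ t - Real.exp (t * m)) 0 t < 0 :=
    h2.filter_mono (nhdsWithin_mono _ fun t ht => ne_of_gt ht)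
  have h4 : ∀ᶠ t in 𝓝[>] (0 : ℝ), t ∈ integrableExpSet f μ :=
    nhdsWithin_le_nhds (mem_interior_iff_mem_nhds.1 h0)
  obtain ⟨t, ht1, ht2, ht3⟩ := (h3.and (h4.and self_mem_nhdsWithin)).exists
  refine ⟨t, ht3, ht2, ?_⟩
  have ht3 : 0 < t := ht3
  simp only [slope_def_field, mgf_zero, zero_mul, Real.exp_zero, sub_self, sub_zero,
    div_neg_iff] at ht1
  rcases ht1 with h | h
  · linarith
  · linarith

lemma exists_measure_pi_le_exp_neg {μ : Measure ℝ} [IsProbabilityMeasure μ]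
    {f : ℝ → ℝ} (h0 : 0 ∈ interior (integrableExpSet f μ)) {m : ℝ} (hm : ∫ x, f x ∂μ < m) :
    ∃ c : ℝ, 0 < c ∧ ∀ n : ℕ, (Measure.pi fun _ : Fin n => μ) {x | m * n ≤ ∑ i, f (x i)} ≤
      ENNReal.ofReal (Real.exp (-(c * n))) := by
  obtain ⟨t, ht, hti, hlt⟩ := exists_mgf_lt_exp h0 hm
  have hpos : 0 < mgf f μ t := mgf_pos hti
  refine ⟨t * m - Real.log (mgf f μ t), ?_, fun n => ?_⟩
  · rw [sub_pos]
    exact (Real.log_lt_iff_lt_exp hpos).2 hlt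
  · have e : (fun x : Fin n → ℝ => Real.exp (t * ∑ i, f (x i))) =
        fun x => ∏ i, Real.exp (t * f (x i)) := by
      ext x
      rw [Finset.mul_sum, Real.exp_sum]
    have hint : Integrable (fun x : Fin n → ℝ => Real.exp (t * ∑ i, f (x i)))
        (Measure.pi fun _ : Fin n => μ) := by
      rw [e]
      exact Integrable.fintype_prod (f := fun _ x => Real.exp (t * f x)) fun _ => hti
    have hmgf : mgf (fun x : Fin n → ℝ => ∑ i, f (x i)) (Measure.pi fun _ : Fin n => μ) t =
        mgf f μ t ^ n := by
      rw [mgf, e, integral_fintype_prod_eq_prod (f := fun _ x => Real.exp (t * f x))]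
      simp [mgf]
    have := measure_ge_le_exp_mul_mgf (m * n) ht.le hint
    rw [hmgf] at this
    rw [← ofReal_measureReal]
    refine ENNReal.ofReal_le_ofReal (this.trans_eq ?_)
    rw [← Real.exp_log hpos, ← Real.exp_nat_mul, ← Real.exp_add, Real.log_exp]
    congr 1; ring

lemma exists_integrable_exp_mul_sq_gaussianReal :
    ∃ a : ℝ, 0 < a ∧ Integrable (fun x : ℝ => Real.exp (a * x ^ 2)) (gaussianReal 0 1) := by
  obtain ⟨a, ha, h⟩ := IsGaussian.exists_integrable_exp_sq (gaussianReal 0 1)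
  exact ⟨a, ha, by simpa using h⟩

lemma zero_mem_interior_integrableExpSet_of_abs_le {f : ℝ → ℝ} (hf : Measurable f) {C : ℝ}
    (hC : ∀ x, |f x| ≤ C * x ^ 2) : 0 ∈ interior (integrableExpSet f (gaussianReal 0 1)) := by
  obtain ⟨a, ha, h⟩ := exists_integrable_exp_mul_sq_gaussianReal
  have hC0 : 0 ≤ C := by
    have := (abs_nonneg _).trans (hC 1)
    linarith
  rw [mem_interior_iff_mem_nhds]
  refine mem_of_superset (Metric.ball_mem_nhds 0 (show 0 < a / (C + 1) by positivity)) fun t ht => ?_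
  rw [mem_ball_zero_iff, Real.norm_eq_abs, lt_div_iff₀ (by positivity)] at ht
  refine h.mono' ?_ (ae_of_all _ fun x => ?_)
  · exact (hf.const_mul t).exp.aestronglyMeasurable
  · rw [Real.norm_of_nonneg (Real.exp_pos _).le, Real.exp_le_exp]
    calc t * f x ≤ |t * f x| := le_abs_self _
      _ = |t| * |f x| := abs_mul _ _
      _ ≤ |t| * (C * x ^ 2) := by gcongr; exact hC x
      _ = (|t| * C) * x ^ 2 := by ring
      _ ≤ a * x ^ 2 := by
        gcongr
        have := abs_nonneg t
        linarith

/-- The Chernoff bound for `∑ f (gᵢ)` with independent standard Gaussian variables `gᵢ`. -/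
theorem exists_stdGaussian_sum_le_exp_neg {f : ℝ → ℝ} (hf : Measurable f) {C : ℝ}
    (hC : ∀ x, |f x| ≤ C * x ^ 2) {m : ℝ} (hm : ∫ x, f x ∂gaussianReal 0 1 < m) :
    ∃ c : ℝ, 0 < c ∧ ∀ n : ℕ, stdGaussian (EuclideanSpace ℝ (Fin n)) {x | m * n ≤ ∑ i, f (x i)} ≤
      ENNReal.ofReal (Real.exp (-(c * n))) := by
  obtain ⟨c, hc, h⟩ := exists_measure_pi_le_exp_neg
    (zero_mem_interior_integrableExpSet_of_abs_le hf hC) hm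
  refine ⟨c, hc, fun n => ?_⟩
  rw [← map_pi_eq_stdGaussian, Measure.map_apply (by fun_prop)]
  · exact h n
  · refine measurableSet_le measurable_const (Finset.measurable_sum _ fun i _ => hf.comp ?_)
    exact (EuclideanSpace.proj i : EuclideanSpace ℝ (Fin n) →L[ℝ] ℝ).continuous.measurable

lemma integrable_gaussianReal_of_abs_le {f : ℝ → ℝ} (hf : Measurable f) {C : ℝ}
    (hC : ∀ x, |f x| ≤ C * x ^ 2) : Integrable f (gaussianReal 0 1) := by
  have h := ((memLp_id_gaussianReal (μ := 0) (v := 1) 2).integrable_sq).const_mul C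
  exact h.mono' hf.aestronglyMeasurable (ae_of_all _ hC)

lemma integral_sq_gaussianReal : ∫ x, x ^ 2 ∂gaussianReal 0 1 = 1 := by
  have h := variance_fun_id_gaussianReal (μ := 0) (v := 1)
  rw [variance_eq_integral (by fun_prop)] at h
  simpa using h

end Chernoff

/-! ### The uniform measure on the sphere: Haar measure and Gaussian measure -/

section Haar
open ProbabilityTheory

variable {n : ℕ}

/-- `Matrix.toEuclideanCLM` as an isomorphism of star monoids. -/
def euclideanStarMulEquiv (n : ℕ) : Matrix (Fin n) (Fin n) ℝ ≃⋆*
    (EuclideanSpace ℝ (Fin n) →L[ℝ] EuclideanSpace ℝ (Fin n)) where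
  toMulEquiv := (Matrix.toEuclideanCLM (n := Fin n) (𝕜 := ℝ) : _ ≃* _)
  map_star' := map_star (Matrix.toEuclideanCLM (n := Fin n) (𝕜 := ℝ))

/-- The isometry of `ℝⁿ` given by an orthogonal matrix. -/
def OGroup.toIsometry (U : OGroup n) : EuclideanSpace ℝ (Fin n) ≃ₗᵢ[ℝ] EuclideanSpace ℝ (Fin n) :=
  Unitary.linearIsometryEquiv (Unitary.mapEquiv
    (euclideanStarMulEquiv n) U)

lemma OGroup.toIsometry_apply (U : OGroup n) (x : EuclideanSpace ℝ (Fin n)) :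
    U.toIsometry x = Matrix.toEuclideanLin (U : Matrix (Fin n) (Fin n) ℝ) x := rfl

lemma OGroup.toIsometry_mul (U V : OGroup n) (x : EuclideanSpace ℝ (Fin n)) :
    (U * V).toIsometry x = U.toIsometry (V.toIsometry x) := by
  rw [OGroup.toIsometry, map_mul, map_mul]
  rfl

lemma OGroup.exists_toIsometry_eq (f : EuclideanSpace ℝ (Fin n) ≃ₗᵢ[ℝ] EuclideanSpace ℝ (Fin n)) :
    ∃ U : OGroup n, U.toIsometry = f := by
  refine ⟨(Unitary.mapEquiv
    (euclideanStarMulEquiv n)).symm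
    (Unitary.linearIsometryEquiv.symm f), ?_⟩
  rw [OGroup.toIsometry, StarMulEquiv.apply_symm_apply]
  exact Unitary.linearIsometryEquiv.apply_symm_apply f

lemma OGroup.exists_toIsometry_apply_eq {x y : EuclideanSpace ℝ (Fin n)} (h : ‖x‖ = ‖y‖) :
    ∃ U : OGroup n, U.toIsometry x = y := by
  obtain ⟨U, hU⟩ := OGroup.exists_toIsometry_eq (Submodule.reflection (ℝ ∙ (x - y))ᗮ)
  exact ⟨U, by rw [hU, Submodule.reflection_sub h]⟩

lemma OGroup.continuous_toIsometry :
    Continuous fun p : OGroup n × EuclideanSpace ℝ (Fin n) => p.1.toIsometry p.2 := by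
  have : (fun p : OGroup n × EuclideanSpace ℝ (Fin n) => p.1.toIsometry p.2) = fun p =>
      WithLp.toLp 2 (Matrix.mulVec (p.1 : Matrix (Fin n) (Fin n) ℝ) (WithLp.ofLp p.2)) := rfl
  rw [this]
  refine (PiLp.continuous_toLp 2 _).comp ?_
  exact Continuous.matrix_mulVec (continuous_subtype_val.comp continuous_fst)
    ((PiLp.continuous_ofLp 2 _).comp continuous_snd)

attribute [irreducible] OGroup.toIsometry

lemma OGroup.measurableSet_toIsometry_mem (x : EuclideanSpace ℝ (Fin n))
    {A : Set (EuclideanSpace ℝ (Fin n))} (hA : MeasurableSet A) :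
    MeasurableSet {U : OGroup n | U.toIsometry x ∈ A} := by
  have : Continuous fun U : OGroup n => U.toIsometry x :=
    OGroup.continuous_toIsometry.comp (continuous_id.prodMk continuous_const)
  exact this.measurable hA

instance OGroup.isTopologicalGroup : IsTopologicalGroup (OGroup n) where

instance : IsProbabilityMeasure (haarO n) := ⟨by
  rw [haarO]
  exact Measure.haarMeasure_self⟩

instance : (haarO n).IsHaarMeasure := by unfold haarO; infer_instance

/-- A right translate of a left Haar measure is a left Haar measure, and the Haar probability
measure is unique. -/
lemma haarO_map_mul_right (V : OGroup n) : (haarO n).map (· * V) = haarO n := by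
  have h1 : Measurable fun U : OGroup n => U * V := (continuous_mul_const V).measurable
  have : IsProbabilityMeasure ((haarO n).map (· * V)) :=
    Measure.isProbabilityMeasure_map h1.aemeasurable
  exact Measure.isHaarMeasure_eq_of_isProbabilityMeasure _ _

lemma haarO_apply_eq_of_norm_eq {x y : EuclideanSpace ℝ (Fin n)} (h : ‖x‖ = ‖y‖)
    {A : Set (EuclideanSpace ℝ (Fin n))} (hA : MeasurableSet A) :
    haarO n {U | U.toIsometry x ∈ A} = haarO n {U | U.toIsometry y ∈ A} := by
  obtain ⟨V, rfl⟩ := OGroup.exists_toIsometry_apply_eq h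
  have h1 : Measurable fun U : OGroup n => U * V := (continuous_mul_const V).measurable
  conv_lhs => rw [← haarO_map_mul_right V, Measure.map_apply h1 (OGroup.measurableSet_toIsometry_mem _ hA)]
  simp only [Set.preimage_ofPred_eq, OGroup.toIsometry_mul]

/-- The rotation of a fixed unit vector by a Haar-distributed orthogonal matrix has the same law
as a normalized Gaussian vector. -/
theorem haarO_apply_eq_stdGaussian {y : EuclideanSpace ℝ (Fin n)} (hy : ‖y‖ = 1)
    {A : Set (EuclideanSpace ℝ (Fin n))} (hA : MeasurableSet A) :
    haarO n {U | U.toIsometry y ∈ A} =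
      stdGaussian (EuclideanSpace ℝ (Fin n)) {g | ‖g‖⁻¹ • g ∈ A} := by
  set γ := stdGaussian (EuclideanSpace ℝ (Fin n))
  set N : EuclideanSpace ℝ (Fin n) → EuclideanSpace ℝ (Fin n) := fun g => ‖g‖⁻¹ • g
  have hN : Measurable N := measurable_norm.inv.smul measurable_id
  have hact : Measurable fun p : OGroup n × EuclideanSpace ℝ (Fin n) => p.1.toIsometry (N p.2) :=
    OGroup.continuous_toIsometry.measurable.comp (measurable_fst.prodMk (hN.comp measurable_snd))
  have hS : MeasurableSet {p : OGroup n × EuclideanSpace ℝ (Fin n) | p.1.toIsometry (N p.2) ∈ A} := hact hA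
  have hU : ∀ U : OGroup n, γ {g | U.toIsometry (N g) ∈ A} = γ {g | N g ∈ A} := by
    intro U
    have e : {g | U.toIsometry (N g) ∈ A} = U.toIsometry ⁻¹' {g | N g ∈ A} := by
      ext g
      simp only [Set.mem_ofPred_eq, Set.mem_preimage, N, map_smul, LinearIsometryEquiv.norm_map]
    rw [e, ← Measure.map_apply (μ := γ) U.toIsometry.continuous.measurable
      (show MeasurableSet {g | N g ∈ A} from hN hA), stdGaussian_map]
  have hg : ∀ᵐ g ∂γ, haarO n {U | U.toIsometry (N g) ∈ A} =
      haarO n {U | U.toIsometry y ∈ A} := by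
    -- The component of `g` along the unit vector `y` is standard normal, so it has no atom at 0.
    have hne : ∀ᵐ g ∂γ, g ≠ 0 := by
      set L : StrongDual ℝ (EuclideanSpace ℝ (Fin n)) := innerSL ℝ y
      have hL : ‖L‖ = 1 := by rw [innerSL_apply_norm, hy]
      have hmap := IsGaussian.map_eq_gaussianReal (μ := γ) L
      rw [integral_strongDual_stdGaussian, variance_dual_stdGaussian, hL] at hmap
      have := nullSingletonClass_gaussianReal (μ := 0) (v := 1) one_ne_zero
      have h0 : γ.map L {0} = 0 := by
        rw [hmap]
        simp
      rw [Measure.map_apply L.continuous.measurable (measurableSet_singleton _)] at h0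
      refine measure_mono_null (fun g hg => ?_) h0
      have : g = 0 := by simpa using hg
      simp [this]
    filter_upwards [hne] with g hg
    refine haarO_apply_eq_of_norm_eq ?_ hA
    rw [hy, norm_smul, norm_inv, norm_norm, inv_mul_cancel₀ (norm_ne_zero_iff.2 hg)]
  -- The product measure is computed in both orders. For fixed `U`, the Gaussian measure is rotation
  -- invariant; for almost every fixed `g`, `N g` is a unit vector and may be exchanged for `y`.
  have h1 : ((haarO n).prod γ) {p | p.1.toIsometry (N p.2) ∈ A} = γ {g | N g ∈ A} := by
    rw [Measure.prod_apply hS]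
    have : ∀ U : OGroup n, γ (Prod.mk U ⁻¹' {p : OGroup n × EuclideanSpace ℝ (Fin n) | p.1.toIsometry (N p.2) ∈ A})
      = γ {g | N g ∈ A} := hU
    rw [lintegral_congr this]
    simp
  have h2 : ((haarO n).prod γ) {p | p.1.toIsometry (N p.2) ∈ A} =
      haarO n {U | U.toIsometry y ∈ A} := by
    rw [Measure.prod_apply_symm hS]
    have : ∀ᵐ g ∂γ, haarO n ((fun U => (U, g)) ⁻¹'
        {p : OGroup n × EuclideanSpace ℝ (Fin n) | p.1.toIsometry (N p.2) ∈ A}) = haarO n {U | U.toIsometry y ∈ A} := hg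
    rw [lintegral_congr_ae this]
    simp
  rw [← h2, h1]

end Haar

/-! ### Nets in the unit sphere of a subspace -/

section Net

/-- Volume comparison: the balls of radius `δ / 2` about the points are disjoint and lie in the ball
of radius `1 + δ / 2`. -/
lemma card_le_of_separated_of_norm_le_one {E : Type*} [NormedAddCommGroup E] [NormedSpace ℝ E]
    [FiniteDimensional ℝ E] {δ : ℝ} (hδ : 0 < δ) (s : Finset E) (hs : ∀ c ∈ s, ‖c‖ ≤ 1)
    (h : ∀ c ∈ s, ∀ d ∈ s, c ≠ d → δ ≤ ‖c - d‖) :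
    (s.card : ℝ) ≤ (1 + 2 / δ) ^ Module.finrank ℝ E := by
  borelize E
  let μ : Measure E := Measure.addHaar
  have hδ2 : 0 < δ / 2 := by positivity
  have hρ : 0 < 1 + δ / 2 := by positivity
  have D : Set.Pairwise (s : Set E) (Function.onFun Disjoint fun c => Metric.ball c (δ / 2)) := by
    rintro c hc d hd hcd
    apply Metric.ball_disjoint_ball
    rw [dist_eq_norm]
    linarith [h c hc d hd hcd]
  have hsub : (⋃ c ∈ s, Metric.ball c (δ / 2)) ⊆ Metric.ball (0 : E) (1 + δ / 2) := by
    refine Set.iUnion₂_subset fun x hx => Metric.ball_subset_ball' ?_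
    rw [dist_zero_right]
    linarith [hs x hx]
  have hvol : (s.card : ℝ≥0∞) * ENNReal.ofReal ((δ / 2) ^ Module.finrank ℝ E) *
      μ (Metric.ball 0 1) ≤
      ENNReal.ofReal ((1 + δ / 2) ^ Module.finrank ℝ E) * μ (Metric.ball 0 1) := by
    calc _ = μ (⋃ c ∈ s, Metric.ball c (δ / 2)) := by
          rw [measure_biUnion_finset D fun c _ => measurableSet_ball]
          simp only [μ.addHaar_ball_of_pos _ hδ2]
          simp only [Finset.sum_const, nsmul_eq_mul, mul_assoc]
      _ ≤ μ (Metric.ball (0 : E) (1 + δ / 2)) := measure_mono hsub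
      _ = _ := by simp only [μ.addHaar_ball_of_pos _ hρ]
  have hJ := (ENNReal.mul_le_mul_iff_left (Metric.measure_ball_pos _ _ zero_lt_one).ne'
    measure_ball_lt_top.ne).1 hvol
  have hK := ENNReal.toReal_le_of_le_ofReal (pow_nonneg hρ.le _) hJ
  rw [ENNReal.toReal_mul, ENNReal.toReal_natCast, ENNReal.toReal_ofReal (by positivity),
    ← le_div_iff₀ (by positivity), ← div_pow] at hK
  refine hK.trans_eq ?_
  congr 1
  field_simp
  ring

/-- The unit sphere of a `d`-dimensional space has a `δ`-net with at most `(1 + 2 / δ) ^ d`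
points. -/
lemma exists_sphere_net {E : Type*} [NormedAddCommGroup E] [NormedSpace ℝ E]
    [FiniteDimensional ℝ E] {δ : ℝ} (hδ : 0 < δ) :
    ∃ s : Finset E, (s.card : ℝ) ≤ (1 + 2 / δ) ^ Module.finrank ℝ E ∧ (∀ y ∈ s, ‖y‖ = 1) ∧
      ∀ x : E, ‖x‖ = 1 → ∃ y ∈ s, ‖x - y‖ ≤ δ := by
  classical
  -- A `δ`-separated set of maximal size is a net, since a point farther than `δ` from it could be
  -- added.
  let S : Set ℕ := {m | ∃ s : Finset E, (∀ y ∈ s, ‖y‖ = 1) ∧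
    (∀ c ∈ s, ∀ d ∈ s, c ≠ d → δ ≤ ‖c - d‖) ∧ s.card = m}
  have hne : S.Nonempty := ⟨0, ∅, by simp⟩
  have hbdd : BddAbove S := by
    refine ⟨⌊(1 + 2 / δ) ^ Module.finrank ℝ E⌋₊, ?_⟩
    rintro m ⟨s, h1, h2, rfl⟩
    exact Nat.le_floor (card_le_of_separated_of_norm_le_one hδ s (fun c hc => (h1 c hc).le) h2)
  obtain ⟨s, h1, h2, h3⟩ := Nat.sSup_mem hne hbdd
  refine ⟨s, card_le_of_separated_of_norm_le_one hδ s (fun c hc => (h1 c hc).le) h2, h1, ?_⟩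
  intro x hx
  by_contra! hfar
  have hxs : x ∉ s := fun h => by
    have := hfar x h
    simp at this
    linarith
  have : s.card + 1 ∈ S := by
    refine ⟨insert x s, ?_, ?_, Finset.card_insert_of_notMem hxs⟩
    · intro y hy
      rcases Finset.mem_insert.1 hy with rfl | hy
      exacts [hx, h1 y hy]
    · intro c hc d hd hcd
      rcases Finset.mem_insert.1 hc with rfl | hc' <;>
        rcases Finset.mem_insert.1 hd with rfl | hd'
      · exact absurd rfl hcd
      · exact (hfar d hd').le
      · rw [norm_sub_rev]; exact (hfar c hc').le
      · exact h2 c hc' d hd' hcd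
  have := le_csSup hbdd this
  omega

lemma Submodule.exists_sphere_net {E : Type*} [NormedAddCommGroup E] [NormedSpace ℝ E]
    (W : Submodule ℝ E) [FiniteDimensional ℝ W] {δ : ℝ} (hδ : 0 < δ) :
    ∃ s : Finset E, (s.card : ℝ) ≤ (1 + 2 / δ) ^ Module.finrank ℝ W ∧ (∀ y ∈ s, ‖y‖ = 1) ∧
      ∀ x ∈ W, ‖x‖ = 1 → ∃ y ∈ s, ‖x - y‖ ≤ δ := by
  classical
  obtain ⟨s, h1, h2, h3⟩ := _root_.exists_sphere_net (E := W) hδ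
  refine ⟨s.image Subtype.val, ?_, ?_, ?_⟩
  · exact le_trans (by exact_mod_cast Finset.card_image_le) h1
  · intro y hy
    obtain ⟨z, hz, rfl⟩ := Finset.mem_image.1 hy
    exact h2 z hz
  · intro x hx hx1
    obtain ⟨y, hy, hxy⟩ := h3 ⟨x, hx⟩ hx1
    exact ⟨y, Finset.mem_image_of_mem _ hy, hxy⟩

lemma finrank_coordSubspace_le (n d : ℕ) : Module.finrank ℝ (coordSubspace n d) ≤ d := by
  classical
  have e : {v : EuclideanSpace ℝ (Fin n) | ∃ i : Fin n, i.val < d ∧ v = EuclideanSpace.single i 1}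
      = ((Finset.univ.filter fun i : Fin n => i.val < d).image
        fun i => EuclideanSpace.single i (1 : ℝ) : Finset _) := by
    ext v
    simp [eq_comm]
  rw [coordSubspace, e]
  refine (finrank_span_finset_le_card _).trans (Finset.card_image_le.trans ?_)
  have := Finset.card_le_card_of_injOn (s := Finset.univ.filter fun i : Fin n => i.val < d)
    (t := Finset.range d) (fun i => i.val) (fun i hi => by simpa using hi)
    (fun i _ j _ h => Fin.ext h)
  simpa using this

end Net

/-! ### Concentration of Lipschitz functions on a random subspace -/

section Concentration
open ProbabilityTheory

variable {n : ℕ}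

lemma sum_sq_eq_norm_sq (x : EuclideanSpace ℝ (Fin n)) : ∑ i, x i ^ 2 = ‖x‖ ^ 2 := by
  rw [EuclideanSpace.norm_sq_eq]
  simp

/-- The norm of a standard Gaussian vector in `ℝⁿ` is close to `√n`. -/
lemma exists_stdGaussian_norm_le_exp_neg {δ : ℝ} (hδ : 0 < δ) (hδ1 : δ < 1) :
    ∃ c : ℝ, 0 < c ∧ ∀ n : ℕ, stdGaussian (EuclideanSpace ℝ (Fin n))
      {g | δ * √n < |√n - ‖g‖|} ≤ ENNReal.ofReal (2 * Real.exp (-(c * n))) := by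
  have hm : Measurable fun x : ℝ => x ^ 2 := measurable_id.pow_const 2
  obtain ⟨c₁, hc₁, h₁⟩ := exists_stdGaussian_sum_le_exp_neg (f := fun x => x ^ 2) (C := 1)
    (m := (1 + δ) ^ 2) hm (fun x => by simp)
    (by rw [integral_sq_gaussianReal]; nlinarith)
  obtain ⟨c₂, hc₂, h₂⟩ := exists_stdGaussian_sum_le_exp_neg (f := fun x => -x ^ 2) (C := 1)
    (m := -(1 - δ) ^ 2) hm.neg (fun x => by simp)
    (by rw [integral_neg, integral_sq_gaussianReal]; nlinarith)
  refine ⟨min c₁ c₂, lt_min hc₁ hc₂, fun n => ?_⟩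
  have hn : √(n : ℝ) ^ 2 = n := Real.sq_sqrt (by positivity)
  have hsub : {g : EuclideanSpace ℝ (Fin n) | δ * √n < |√n - ‖g‖|} ⊆
      {x | (1 + δ) ^ 2 * n ≤ ∑ i, x i ^ 2} ∪ {x | -(1 - δ) ^ 2 * n ≤ ∑ i, -x i ^ 2} := by
    intro g hg
    rcases lt_abs.1 (show δ * √n < |√n - ‖g‖| from hg) with h | h
    · right
      rw [Set.mem_ofPred_eq, Finset.sum_neg_distrib, sum_sq_eq_norm_sq]
      have : ‖g‖ ^ 2 ≤ ((1 - δ) * √n) ^ 2 :=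
        pow_le_pow_left₀ (norm_nonneg _) (by linarith) 2
      rw [mul_pow, hn] at this
      linarith
    · left
      rw [Set.mem_ofPred_eq, sum_sq_eq_norm_sq]
      have : ((1 + δ) * √n) ^ 2 ≤ ‖g‖ ^ 2 :=
        pow_le_pow_left₀ (by positivity) (by linarith) 2
      rwa [mul_pow, hn] at this
  refine (measure_mono hsub).trans ((measure_union_le _ _).trans ?_)
  rw [two_mul, ENNReal.ofReal_add (by positivity) (by positivity)]
  have e₁ : Real.exp (-(c₁ * n)) ≤ Real.exp (-(min c₁ c₂ * n)) := by
    gcongr; exact min_le_left _ _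
  have e₂ : Real.exp (-(c₂ * n)) ≤ Real.exp (-(min c₁ c₂ * n)) := by
    gcongr; exact min_le_right _ _
  exact add_le_add ((h₁ n).trans (ENNReal.ofReal_le_ofReal e₁))
    ((h₂ n).trans (ENNReal.ofReal_le_ofReal e₂))

/-- Moving `g` radially to the sphere of radius `r` costs only the error in its norm; at `g = 0` the
convention `0⁻¹ = 0` keeps the bound true. -/
lemma norm_smul_inv_norm_smul_sub_le (r : ℝ) (g : EuclideanSpace ℝ (Fin n)) :
    ‖r • ‖g‖⁻¹ • g - g‖ ≤ |r - ‖g‖| := by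
  by_cases hg : g = 0
  · simp [hg]
  · have hg' : ‖g‖ ≠ 0 := norm_ne_zero_iff.2 hg
    have : r • ‖g‖⁻¹ • g - g = ((r - ‖g‖) * ‖g‖⁻¹) • g := by
      rw [smul_smul, sub_mul, mul_inv_cancel₀ hg', sub_smul, one_smul]
    rw [this, norm_smul, norm_mul, norm_inv, norm_norm, mul_assoc, inv_mul_cancel₀ hg', mul_one,
      Real.norm_eq_abs]

/-- A tail bound for a Lipschitz function at a uniformly random point of the sphere, from the
tail bound at a Gaussian vector. -/
lemma haarO_lt_apply_le {F : EuclideanSpace ℝ (Fin n) → ℝ} {K : ℝ≥0} (hF : LipschitzWith K F)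
    {y : EuclideanSpace ℝ (Fin n)} (hy : ‖y‖ = 1) (m δ : ℝ) :
    haarO n {U | (m + K * δ) * √n < F (√n • U.toIsometry y)} ≤
      stdGaussian (EuclideanSpace ℝ (Fin n)) {g | m * √n < F g} +
      stdGaussian (EuclideanSpace ℝ (Fin n)) {g | δ * √n < |√n - ‖g‖|} := by
  have hA : MeasurableSet {x : EuclideanSpace ℝ (Fin n) | (m + K * δ) * √n < F (√n • x)} :=
    measurableSet_lt measurable_const
      (hF.continuous.comp (continuous_const_smul (√(n : ℝ)))).measurable
  refine (haarO_apply_eq_stdGaussian hy hA).trans_le ?_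
  refine (measure_mono fun g hg => ?_).trans (measure_union_le _ _)
  by_contra hcon
  simp only [Set.mem_union, Set.mem_ofPred_eq, not_or, not_lt] at hcon hg
  have h1 := hF.dist_le_mul (√n • ‖g‖⁻¹ • g) g
  rw [dist_eq_norm, dist_eq_norm, Real.norm_eq_abs] at h1
  have h2 := (le_abs_self _).trans h1
  have h3 : (K : ℝ) * ‖√n • ‖g‖⁻¹ • g - g‖ ≤ K * (δ * √n) :=
    mul_le_mul_of_nonneg_left ((norm_smul_inv_norm_smul_sub_le _ g).trans hcon.2) K.2
  linarith [hcon.1]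

/-- The union bound over a net of the sphere of a subspace. -/
lemma haarO_exists_lt_apply_le {F : EuclideanSpace ℝ (Fin n) → ℝ} {K : ℝ≥0}
    (hF : LipschitzWith K F) (W : Submodule ℝ (EuclideanSpace ℝ (Fin n))) {m δ : ℝ} (hδ : 0 < δ)
    {p : ℝ≥0∞}
    (hp : ∀ y : EuclideanSpace ℝ (Fin n), ‖y‖ = 1 →
      haarO n {U | m * √n < F (√n • U.toIsometry y)} ≤ p) :
    haarO n {U | ∃ x ∈ W, ‖x‖ = 1 ∧ (m + K * δ) * √n < F (√n • U.toIsometry x)} ≤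
      ENNReal.ofReal ((1 + 2 / δ) ^ Module.finrank ℝ W) * p := by
  obtain ⟨s, hs1, hs2, hs3⟩ := W.exists_sphere_net hδ
  calc _ ≤ haarO n (⋃ y ∈ s, {U | m * √n < F (√n • U.toIsometry y)}) := by
        refine measure_mono ?_
        rintro U ⟨x, hxW, hx1, hx⟩
        obtain ⟨y, hy, hxy⟩ := hs3 x hxW hx1
        refine Set.mem_iUnion₂.2 ⟨y, hy, ?_⟩
        have h1 := hF.dist_le_mul (√n • U.toIsometry x) (√n • U.toIsometry y)
        rw [dist_eq_norm, dist_eq_norm, Real.norm_eq_abs, ← smul_sub, ← map_sub, norm_smul,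
          LinearIsometryEquiv.norm_map, Real.norm_of_nonneg (Real.sqrt_nonneg _)] at h1
        have h2 := (le_abs_self _).trans h1
        have h3 : (K : ℝ) * (√n * ‖x - y‖) ≤ K * (√n * δ) := by gcongr
        rw [Set.mem_ofPred_eq]
        linarith
    _ ≤ ∑ y ∈ s, haarO n {U | m * √n < F (√n • U.toIsometry y)} := measure_biUnion_finset_le _ _
    _ ≤ ∑ y ∈ s, p := Finset.sum_le_sum fun y hy => hp y (hs2 y hy)
    _ = s.card * p := by rw [Finset.sum_const, nsmul_eq_mul]
    _ ≤ _ := by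
        gcongr
        rw [← ENNReal.ofReal_natCast]
        exact ENNReal.ofReal_le_ofReal hs1

lemma mem_rotatedSubspace {d : ℕ} {U : OGroup n} {x : EuclideanSpace ℝ (Fin n)} :
    x ∈ rotatedSubspace d U ↔ ∃ y ∈ coordSubspace n d, U.toIsometry y = x := by
  simp only [rotatedSubspace, Submodule.mem_map, OGroup.toIsometry_apply]

/-- If the Lipschitz functions `F n` are at most `m √n` at a Gaussian vector up to exponentially
small probability, then with high probability they are at most `m' √n` on the sphere of radius
`√n` of a uniformly random subspace of small proportional dimension. -/
theorem exists_tendsto_haarO_rotatedSubspace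
    {F : (n : ℕ) → EuclideanSpace ℝ (Fin n) → ℝ} {K : ℝ≥0} (hF : ∀ n, LipschitzWith K (F n))
    {m m' c : ℝ} (hm : m < m') (hc : 0 < c)
    (h : ∀ n, stdGaussian (EuclideanSpace ℝ (Fin n)) {g | m * √n < F n g} ≤
      ENNReal.ofReal (Real.exp (-(c * n)))) :
    ∃ α₀ : ℝ, 0 < α₀ ∧ ∀ α, 0 < α → α ≤ α₀ →
      Tendsto (fun n : ℕ => haarO n {U | ∃ x ∈ rotatedSubspace (⌊α * n⌋₊ + 1) U, ‖x‖ = 1 ∧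
        m' * √n < F n (√n • x)}) atTop (𝓝 0) := by
  -- One loss `K * δ` pays for normalizing the Gaussian vector, the other for passing from the net
  -- to the whole sphere.
  obtain ⟨δ, hδ, hδ1, hδK⟩ : ∃ δ : ℝ, 0 < δ ∧ δ < 1 ∧ m + K * δ + K * δ ≤ m' := by
    have hK : (0 : ℝ) ≤ K := K.2
    refine ⟨min (1 / 2) ((m' - m) / (2 * (K + 1))), ?_, ?_, ?_⟩
    · have : 0 < m' - m := sub_pos.2 hm
      positivity
    · exact (min_le_left _ _).trans_lt (by norm_num)
    · have h1 : min (1 / 2) ((m' - m) / (2 * (K + 1))) ≤ (m' - m) / (2 * (K + 1)) :=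
        min_le_right _ _
      rw [le_div_iff₀ (by positivity)] at h1
      have h2 : 0 < min (1 / 2) ((m' - m) / (2 * (K + 1))) := by
        have : 0 < m' - m := sub_pos.2 hm
        positivity
      nlinarith
  obtain ⟨c', hc', h'⟩ := exists_stdGaussian_norm_le_exp_neg hδ hδ1
  set B : ℝ := 1 + 2 / δ
  have hB : 1 < B := by
    have : 0 < 2 / δ := by positivity
    simp only [B]; linarith
  have hlogB : 0 < Real.log B := Real.log_pos hB
  set c₀ := min c c'
  have hc₀ : 0 < c₀ := lt_min hc hc'
  -- With this `α₀` the net has at most `B * exp (c₀ n / 2)` points, which uses up only half of the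
  -- exponent in the tail bound.
  refine ⟨c₀ / (2 * Real.log B), by positivity, fun α hα hα₀ => ?_⟩
  rw [le_div_iff₀ (by positivity)] at hα₀
  have bound : ∀ n : ℕ, haarO n {U | ∃ x ∈ rotatedSubspace (⌊α * n⌋₊ + 1) U, ‖x‖ = 1 ∧
        m' * √n < F n (√n • x)} ≤ ENNReal.ofReal (3 * B * Real.exp (-(c₀ / 2 * n))) := by
    intro n
    have hp : ∀ y : EuclideanSpace ℝ (Fin n), ‖y‖ = 1 →
        haarO n {U | (m + K * δ) * √n < F n (√n • U.toIsometry y)} ≤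
          ENNReal.ofReal (3 * Real.exp (-(c₀ * n))) := by
      intro y hy
      refine (haarO_lt_apply_le (hF n) hy m δ).trans ((add_le_add (h n) (h' n)).trans ?_)
      rw [← ENNReal.ofReal_add (by positivity) (by positivity)]
      refine ENNReal.ofReal_le_ofReal ?_
      have e₁ : Real.exp (-(c * n)) ≤ Real.exp (-(c₀ * n)) := by
        gcongr; exact min_le_left _ _
      have e₂ : Real.exp (-(c' * n)) ≤ Real.exp (-(c₀ * n)) := by
        gcongr; exact min_le_right _ _
      linarith
    have key := haarO_exists_lt_apply_le (hF n) (coordSubspace n (⌊α * n⌋₊ + 1)) hδ hp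
    refine (measure_mono ?_).trans (key.trans ?_)
    · rintro U ⟨x, hx, hx1, hxF⟩
      obtain ⟨y, hy, rfl⟩ := mem_rotatedSubspace.1 hx
      refine ⟨y, hy, by rwa [LinearIsometryEquiv.norm_map] at hx1, lt_of_le_of_lt ?_ hxF⟩
      gcongr
    · rw [← ENNReal.ofReal_mul (by positivity)]
      refine ENNReal.ofReal_le_ofReal ?_
      have hpow : B ^ Module.finrank ℝ (coordSubspace n (⌊α * n⌋₊ + 1)) ≤
          B * Real.exp (c₀ / 2 * n) := by
        calc _ ≤ B ^ (⌊α * n⌋₊ + 1) := pow_le_pow_right₀ hB.le (finrank_coordSubspace_le _ _)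
          _ = B * Real.exp (⌊α * n⌋₊ * Real.log B) := by
            rw [pow_succ', Real.exp_nat_mul, Real.exp_log (by linarith)]
          _ ≤ B * Real.exp (c₀ / 2 * n) := by
            refine mul_le_mul_of_nonneg_left (Real.exp_le_exp.2 ?_) (by linarith)
            have h1 : (⌊α * n⌋₊ : ℝ) ≤ α * n := Nat.floor_le (by positivity)
            calc (⌊α * n⌋₊ : ℝ) * Real.log B ≤ α * n * Real.log B := by gcongr
              _ = (α * (2 * Real.log B)) / 2 * n := by ring
              _ ≤ c₀ / 2 * n := by gcongr
      calc _ ≤ B * Real.exp (c₀ / 2 * n) * (3 * Real.exp (-(c₀ * n))) := by gcongr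
        _ = 3 * B * (Real.exp (c₀ / 2 * n) * Real.exp (-(c₀ * n))) := by ring
        _ = _ := by
          rw [← Real.exp_add]
          congr 2; ring
  refine tendsto_of_tendsto_of_tendsto_of_le_of_le tendsto_const_nhds ?_ (fun _ => zero_le) bound
  rw [← ENNReal.ofReal_zero]
  refine (ENNReal.continuous_ofReal.tendsto 0).comp ?_
  have h1 : Tendsto (fun n : ℕ => c₀ / 2 * (n : ℝ)) atTop atTop :=
    tendsto_natCast_atTop_atTop.const_mul_atTop (by positivity)
  simpa using (Real.tendsto_exp_neg_atTop_nhds_zero.comp h1).const_mul (3 * B)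

end Concentration

/-! ### Normalized coordinatewise maps of the sphere -/

section CoordMap

/-- The coordinatewise application of `φ`. -/
def coordMap (φ : ℝ → ℝ) {n : ℕ} (x : EuclideanSpace ℝ (Fin n)) : EuclideanSpace ℝ (Fin n) :=
  WithLp.toLp 2 fun i => φ (x i)

variable {φ : ℝ → ℝ} {n : ℕ}

lemma coordApply_eq (x : EuclideanSpace ℝ (Fin n)) :
    coordApply φ x = coordMap φ (√n • x) := rfl

lemma norm_le_mul_norm_of_abs_le {x y : EuclideanSpace ℝ (Fin n)} {c : ℝ} (hc : 0 ≤ c)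
    (h : ∀ i, |x i| ≤ c * |y i|) : ‖x‖ ≤ c * ‖y‖ := by
  refine (pow_le_pow_iff_left₀ (norm_nonneg _) (by positivity) two_ne_zero).1 ?_
  rw [mul_pow, ← sum_sq_eq_norm_sq, ← sum_sq_eq_norm_sq, Finset.mul_sum]
  refine Finset.sum_le_sum fun i _ => ?_
  rw [← sq_abs (x i), ← sq_abs (y i), ← mul_pow]
  exact pow_le_pow_left₀ (abs_nonneg _) (h i) 2

lemma sum_abs_mul_abs_le (x y : EuclideanSpace ℝ (Fin n)) : ∑ i, |x i| * |y i| ≤ ‖x‖ * ‖y‖ := by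
  have := Real.sum_mul_le_sqrt_mul_sqrt Finset.univ (fun i => |x i|) (fun i => |y i|)
  simpa [EuclideanSpace.norm_eq] using this

/-- The slopes of `φ` lie between `a` and `b`. -/
def SlopesIn (φ : ℝ → ℝ) (a b : ℝ) : Prop :=
  ∀ x y, x ≤ y → a * (y - x) ≤ φ y - φ x ∧ φ y - φ x ≤ b * (y - x)

namespace SlopesIn
variable {a b : ℝ}

lemma strictMono (h : SlopesIn φ a b) (ha : 0 < a) : StrictMono φ := fun x y hxy => by
  have := (h x y hxy.le).1
  have := mul_pos ha (sub_pos.2 hxy)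
  linarith

lemma abs_sub (h : SlopesIn φ a b) (ha : 0 < a) (x y : ℝ) :
    a * |x - y| ≤ |φ x - φ y| ∧ |φ x - φ y| ≤ b * |x - y| := by
  have hm := (h.strictMono ha).monotone
  rcases le_total x y with hxy | hxy
  · rw [abs_sub_comm x, abs_sub_comm (φ x), abs_of_nonneg (sub_nonneg.2 hxy),
      abs_of_nonneg (sub_nonneg.2 (hm hxy))]
    exact h x y hxy
  · rw [abs_of_nonneg (sub_nonneg.2 hxy), abs_of_nonneg (sub_nonneg.2 (hm hxy))]
    exact h y x hxy

lemma norm_coordMap_sub_le (h : SlopesIn φ a b) (ha : 0 < a) (hb : 0 < b)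
    (x y : EuclideanSpace ℝ (Fin n)) : ‖coordMap φ x - coordMap φ y‖ ≤ b * ‖x - y‖ :=
  norm_le_mul_norm_of_abs_le hb.le fun i => (h.abs_sub ha (x i) (y i)).2

lemma le_norm_coordMap_sub (h : SlopesIn φ a b) (ha : 0 < a)
    (x y : EuclideanSpace ℝ (Fin n)) : a * ‖x - y‖ ≤ ‖coordMap φ x - coordMap φ y‖ := by
  have := norm_le_mul_norm_of_abs_le (x := x - y) (y := coordMap φ x - coordMap φ y)
    (inv_nonneg.2 ha.le) fun i => by
      rw [← div_eq_inv_mul, le_div_iff₀ ha, mul_comm]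
      exact (h.abs_sub ha (x i) (y i)).1
  rwa [← div_eq_inv_mul, le_div_iff₀ ha, mul_comm] at this

lemma coordMap_zero (h0 : φ 0 = 0) : coordMap φ (0 : EuclideanSpace ℝ (Fin n)) = 0 := by
  ext i
  simp [coordMap, h0]

lemma norm_coordMap_le (h : SlopesIn φ a b) (ha : 0 < a) (hb : 0 < b) (h0 : φ 0 = 0)
    (x : EuclideanSpace ℝ (Fin n)) : ‖coordMap φ x‖ ≤ b * ‖x‖ := by
  simpa [coordMap_zero h0] using h.norm_coordMap_sub_le ha hb x 0

lemma le_norm_coordMap (h : SlopesIn φ a b) (ha : 0 < a) (h0 : φ 0 = 0)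
    (x : EuclideanSpace ℝ (Fin n)) : a * ‖x‖ ≤ ‖coordMap φ x‖ := by
  simpa [coordMap_zero h0] using h.le_norm_coordMap_sub ha x 0

/-- The coordinatewise inequality behind the Lipschitz bound for the inverse. -/
lemma mul_sub_ge (h : SlopesIn φ a b) (ha : 0 < a) (hb : 0 < b) (h0 : φ 0 = 0) {τ : ℝ}
    (hτ : 1 ≤ τ) (x y : ℝ) :
    a / b * (τ - 1) * y ^ 2 - a⁻¹ * (|y| * |φ x - τ * φ y|) ≤ y * (x - y) := by
  have hy : a * y ^ 2 ≤ y * φ y := by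
    have h1 := (h.abs_sub ha y 0).1
    rw [h0, sub_zero, sub_zero] at h1
    have h2 : 0 ≤ y * φ y := by
      rcases le_total 0 y with hy | hy
      · have := (h.strictMono ha).monotone hy
        rw [h0] at this
        positivity
      · have := (h.strictMono ha).monotone hy
        rw [h0] at this
        exact mul_nonneg_of_nonpos_of_nonpos hy this
    calc a * y ^ 2 = |y| * (a * |y|) := by rw [← sq_abs]; ring
      _ ≤ |y| * |φ y| := by gcongr
      _ = y * φ y := by rw [← abs_mul, abs_of_nonneg h2]
  -- `κ` is the inverse secant slope; then `φ x - φ y` is split as `(φ x - τ * φ y) + (τ - 1) * φ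
  -- y`.
  obtain ⟨κ, hκ1, hκ2, hκ⟩ : ∃ κ, b⁻¹ ≤ κ ∧ κ ≤ a⁻¹ ∧ x - y = κ * (φ x - φ y) := by
    have hab : b⁻¹ ≤ a⁻¹ := by
      have := h 0 1 zero_le_one
      exact inv_anti₀ ha (by linarith)
    by_cases hxy : x = y
    · exact ⟨b⁻¹, le_rfl, hab, by simp [hxy]⟩
    · have hne : φ x - φ y ≠ 0 := sub_ne_zero.2 fun e => hxy ((h.strictMono ha).injective e)
      have key : ∀ x y, x < y → b⁻¹ ≤ (y - x) / (φ y - φ x) ∧ (y - x) / (φ y - φ x) ≤ a⁻¹ := by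
        intro x y hlt
        obtain ⟨h1, h2⟩ := h x y hlt.le
        have h3 : 0 < φ y - φ x := sub_pos.2 (h.strictMono ha hlt)
        rw [le_div_iff₀ h3, div_le_iff₀ h3, inv_mul_le_iff₀ hb, ← div_eq_inv_mul, le_div_iff₀ ha]
        exact ⟨h2, by linarith⟩
      refine ⟨(x - y) / (φ x - φ y), ?_, ?_, by field_simp⟩
      · rcases lt_or_gt_of_ne hxy with hlt | hlt
        · rw [← neg_sub y, ← neg_sub (φ y), neg_div_neg_eq]
          exact (key x y hlt).1
        · exact (key y x hlt).1
      · rcases lt_or_gt_of_ne hxy with hlt | hlt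
        · rw [← neg_sub y, ← neg_sub (φ y), neg_div_neg_eq]
          exact (key x y hlt).2
        · exact (key y x hlt).2
  have hκ0 : 0 < κ := (inv_pos.2 hb).trans_le hκ1
  have e : y * (x - y) = κ * (y * (φ x - τ * φ y)) + κ * ((τ - 1) * (y * φ y)) := by
    rw [hκ]; ring
  have h1 : a / b * (τ - 1) * y ^ 2 ≤ κ * ((τ - 1) * (y * φ y)) := by
    have hτ' : 0 ≤ τ - 1 := sub_nonneg.2 hτ
    calc a / b * (τ - 1) * y ^ 2 = b⁻¹ * ((τ - 1) * (a * y ^ 2)) := by ring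
      _ ≤ κ * ((τ - 1) * (y * φ y)) := by gcongr
  have h2 : -(a⁻¹ * (|y| * |φ x - τ * φ y|)) ≤ κ * (y * (φ x - τ * φ y)) := by
    rw [← abs_mul, neg_le]
    calc -(κ * (y * (φ x - τ * φ y))) ≤ κ * |y * (φ x - τ * φ y)| := by
          rw [← mul_neg]
          exact mul_le_mul_of_nonneg_left (neg_le_abs _) hκ0.le
      _ ≤ _ := by gcongr
  linarith

/-- Write `u = τ v + w` with `τ = ‖u‖ / ‖v‖ ≥ 1`, so that `‖w‖` is `‖u‖` times the distance of the
normalized vectors. An excess `τ - 1` pushes `x` outward from `y`, whereas equal norms force `⟨y, x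
- y⟩ ≤ 0`. Summing `mul_sub_ge` over coordinates therefore bounds `(τ - 1) R`, and with it `‖u -
v‖`, by a multiple of `‖w‖`. -/
lemma norm_sub_le_of_norm_le (h : SlopesIn φ a b) (ha : 0 < a) (hb : 0 < b) (h0 : φ 0 = 0)
    {R : ℝ} (hR : 0 < R) {x y : EuclideanSpace ℝ (Fin n)} (hx : ‖x‖ = R) (hy : ‖y‖ = R)
    (hle : ‖coordMap φ y‖ ≤ ‖coordMap φ x‖) :
    ‖x - y‖ ≤ b / a * (1 + b ^ 2 / a ^ 2) * R *
      ‖‖coordMap φ x‖⁻¹ • coordMap φ x - ‖coordMap φ y‖⁻¹ • coordMap φ y‖ := by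
  set u := coordMap φ x with hu
  set v := coordMap φ y with hv
  have hvpos : 0 < ‖v‖ := lt_of_lt_of_le (by rw [hy]; positivity) (h.le_norm_coordMap ha h0 y)
  have hupos : 0 < ‖u‖ := hvpos.trans_le hle
  set τ := ‖u‖ / ‖v‖ with hτ_def
  have hτ : 1 ≤ τ := (one_le_div hvpos).2 hle
  set w := u - τ • v with hw_def
  have hw : ‖w‖ = ‖u‖ * ‖‖u‖⁻¹ • u - ‖v‖⁻¹ • v‖ := by
    rw [← norm_norm u, ← norm_smul, norm_norm, smul_sub, smul_smul, smul_smul,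
      mul_inv_cancel₀ hupos.ne', one_smul, ← div_eq_mul_inv]
  have hsum : ∑ i, (a / b * (τ - 1) * y i ^ 2 - a⁻¹ * (|y i| * |w i|)) ≤
      ∑ i, y i * (x i - y i) :=
    Finset.sum_le_sum fun i _ => h.mul_sub_ge ha hb h0 hτ (x i) (y i)
  have hnonpos : ∑ i, y i * (x i - y i) ≤ 0 := by
    have e : ∑ i, y i * (x i - y i) = inner ℝ x y - ‖y‖ ^ 2 := by
      rw [← sum_sq_eq_norm_sq, PiLp.inner_apply, ← Finset.sum_sub_distrib]
      refine Finset.sum_congr rfl fun i _ => ?_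
      simp only [RCLike.inner_apply, conj_trivial]
      ring
    have := real_inner_le_norm x y
    rw [hx, hy] at this
    rw [e, hy]
    linarith
  rw [Finset.sum_sub_distrib, ← Finset.mul_sum, ← Finset.mul_sum, sum_sq_eq_norm_sq, hy] at hsum
  have hcs := sum_abs_mul_abs_le y w
  rw [hy] at hcs
  have h1 : a / b * (τ - 1) * R ^ 2 ≤ a⁻¹ * (R * ‖w‖) := by
    have := mul_le_mul_of_nonneg_left hcs (inv_nonneg.2 ha.le)
    linarith
  have h2 : (τ - 1) * R ≤ b / a ^ 2 * ‖w‖ := by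
    have e1 : a / b * (τ - 1) * R ^ 2 = (a / b * R) * ((τ - 1) * R) := by ring
    have e2 : a⁻¹ * (R * ‖w‖) = (a / b * R) * (b / a ^ 2 * ‖w‖) := by field_simp
    rw [e1, e2] at h1
    exact le_of_mul_le_mul_left h1 (by positivity)
  have h3 : ‖u - v‖ ≤ (1 + b ^ 2 / a ^ 2) * ‖w‖ := by
    have e : u - v = w + (τ - 1) • v := by rw [hw_def, sub_smul, one_smul]; abel
    have hvb : ‖v‖ ≤ b * R := hy ▸ h.norm_coordMap_le ha hb h0 y
    have hτ' : 0 ≤ τ - 1 := sub_nonneg.2 hτ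
    calc ‖u - v‖ ≤ ‖w‖ + ‖(τ - 1) • v‖ := by rw [e]; exact norm_add_le _ _
      _ = ‖w‖ + (τ - 1) * ‖v‖ := by rw [norm_smul, Real.norm_of_nonneg hτ']
      _ ≤ ‖w‖ + (τ - 1) * (b * R) := by gcongr
      _ = ‖w‖ + b * ((τ - 1) * R) := by ring
      _ ≤ ‖w‖ + b * (b / a ^ 2 * ‖w‖) := by gcongr
      _ = _ := by ring
  have h4 := h.le_norm_coordMap_sub ha x y
  have hub : ‖u‖ ≤ b * R := hx ▸ h.norm_coordMap_le ha hb h0 x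
  rw [hw] at h3
  have h5 : ‖x - y‖ ≤ a⁻¹ * ‖u - v‖ := by
    rw [← div_eq_inv_mul, le_div_iff₀ ha, mul_comm]; exact h4
  calc ‖x - y‖ ≤ a⁻¹ * ‖u - v‖ := h5
    _ ≤ a⁻¹ * ((1 + b ^ 2 / a ^ 2) * (‖u‖ * ‖‖u‖⁻¹ • u - ‖v‖⁻¹ • v‖)) := by gcongr
    _ ≤ a⁻¹ * ((1 + b ^ 2 / a ^ 2) * (b * R * ‖‖u‖⁻¹ • u - ‖v‖⁻¹ • v‖)) := by gcongr
    _ = _ := by ring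

/-- The normalized coordinatewise map has a Lipschitz inverse. -/
lemma norm_sub_le (h : SlopesIn φ a b) (ha : 0 < a) (hb : 0 < b) (h0 : φ 0 = 0)
    {R : ℝ} (hR : 0 < R) {x y : EuclideanSpace ℝ (Fin n)} (hx : ‖x‖ = R) (hy : ‖y‖ = R) :
    ‖x - y‖ ≤ b / a * (1 + b ^ 2 / a ^ 2) * R *
      ‖‖coordMap φ x‖⁻¹ • coordMap φ x - ‖coordMap φ y‖⁻¹ • coordMap φ y‖ := by
  rcases le_total ‖coordMap φ y‖ ‖coordMap φ x‖ with hle | hle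
  · exact h.norm_sub_le_of_norm_le ha hb h0 hR hx hy hle
  · rw [norm_sub_rev x, norm_sub_rev (‖coordMap φ x‖⁻¹ • _)]
    exact h.norm_sub_le_of_norm_le ha hb h0 hR hy hx hle

lemma surjective (h : SlopesIn φ a b) (ha : 0 < a) (hc : Continuous φ) :
    Function.Surjective φ := by
  refine hc.surjective ?_ ?_
  · refine tendsto_atTop_mono' _ ?_
      (tendsto_atTop_add_const_right _ (φ 0) (tendsto_id.const_mul_atTop ha))
    filter_upwards [eventually_ge_atTop 0] with x hx
    have := (h 0 x hx).1
    simp only [id]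
    linarith
  · refine tendsto_atBot_mono' _ ?_
      (tendsto_atBot_add_const_right _ (φ 0) (tendsto_id.const_mul_atBot ha))
    filter_upwards [eventually_le_atBot 0] with x hx
    have := (h x 0 hx).1
    simp only [id]
    linarith

/-- The preimage of the ray through `y` is a continuous curve whose norm grows from 0 to at least
`R` by parameter `b * R`, so it meets the sphere of radius `R`. This gives surjectivity of `ψ`. -/
lemma exists_coordMap_eq_smul (h : SlopesIn φ a b) (ha : 0 < a) (hb : 0 < b) (h0 : φ 0 = 0)
    (hc : Continuous φ) {R : ℝ} (hR : 0 < R) {y : EuclideanSpace ℝ (Fin n)} (hy : ‖y‖ = 1) :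
    ∃ x : EuclideanSpace ℝ (Fin n), ∃ t : ℝ, 0 < t ∧ ‖x‖ = R ∧ coordMap φ x = t • y := by
  set e := (h.strictMono ha).orderIsoOfSurjective φ (h.surjective ha hc)
  have he : ∀ t, φ (e.symm t) = t := fun t => e.apply_symm_apply t
  set G : ℝ → EuclideanSpace ℝ (Fin n) := fun t => coordMap e.symm (t • y)
  have hG : ∀ t, coordMap φ (G t) = t • y := by
    intro t
    ext i
    simp [G, coordMap, he]
  have hGc : Continuous G := by
    refine (PiLp.continuous_toLp 2 _).comp (continuous_pi fun i => e.symm.continuous.comp ?_)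
    exact continuous_id.mul continuous_const
  have hG0 : ‖G 0‖ = 0 := by
    have h1 := h.le_norm_coordMap ha h0 (G 0)
    rw [hG, zero_smul, norm_zero] at h1
    exact le_antisymm (by nlinarith) (norm_nonneg _)
  have hG1 : R ≤ ‖G (b * R)‖ := by
    have h1 := h.norm_coordMap_le ha hb h0 (G (b * R))
    rw [hG, norm_smul, hy, mul_one, Real.norm_of_nonneg (by positivity)] at h1
    exact le_of_mul_le_mul_left h1 hb
  obtain ⟨t, ht, htR⟩ := intermediate_value_Icc (show 0 ≤ b * R by positivity)
    hGc.norm.continuousOn (show R ∈ Set.Icc ‖G 0‖ ‖G (b * R)‖ from ⟨by rw [hG0]; exact hR.le, hG1⟩)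
  refine ⟨G t, t, lt_of_le_of_ne ht.1 ?_, htR, hG t⟩
  rintro rfl
  simp only at htR
  linarith

lemma norm_normalize_sub_le {E : Type*} [NormedAddCommGroup E] [NormedSpace ℝ E] {u v : E}
    (hu : u ≠ 0) (hv : v ≠ 0) : ‖‖u‖⁻¹ • u - ‖v‖⁻¹ • v‖ ≤ 2 * ‖u‖⁻¹ * ‖u - v‖ := by
  have hu' := norm_pos_iff.2 hu
  have hv' := norm_pos_iff.2 hv
  have e : ‖u‖⁻¹ • u - ‖v‖⁻¹ • v = ‖u‖⁻¹ • (u - v) + (‖u‖⁻¹ * (‖v‖ - ‖u‖) * ‖v‖⁻¹) • v := by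
    have : ‖u‖⁻¹ * (‖v‖ - ‖u‖) * ‖v‖⁻¹ = ‖u‖⁻¹ - ‖v‖⁻¹ := by field_simp
    rw [this, smul_sub, sub_smul]
    abel
  rw [e]
  refine (norm_add_le _ _).trans ?_
  rw [norm_smul, norm_smul, norm_mul, norm_mul, norm_inv, norm_inv, norm_norm, norm_norm,
    mul_assoc (_ * _), inv_mul_cancel₀ hv'.ne', mul_one, Real.norm_eq_abs, mul_assoc, two_mul]
  rw [← mul_add, ← mul_add]
  gcongr
  rw [abs_sub_comm]
  exact abs_norm_sub_norm_le u v

end SlopesIn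

/-- A coordinatewise map with slopes bounded above and below induces, after normalization,
homeomorphisms of the spheres that are bi-Lipschitz uniformly in the dimension. -/
theorem exists_isNormalizedCoordMap {a b : ℝ} (h : SlopesIn φ a b) (ha : 0 < a) (hb : 0 < b)
    (hc : Continuous φ) (hodd : ∀ x, φ (-x) = -φ x) :
    ∃ L : ℝ≥0, ∀ n : ℕ, ∃ ψ : USphere n → USphere n, IsNormalizedCoordMap φ ψ ∧ Continuous ψ ∧
      (∀ x : USphere n, ψ (-x) = -ψ x) ∧ Function.Bijective ψ ∧
      LipschitzWith L ψ ∧ AntilipschitzWith L ψ := by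
  have h0 : φ 0 = 0 := by
    have := hodd 0
    rw [neg_zero] at this
    linarith
  refine ⟨max (2 * b / a).toNNReal (b / a * (1 + b ^ 2 / a ^ 2)).toNNReal, fun n => ?_⟩
  -- For `n = 0` the sphere is empty; a point `x` is what guarantees `n > 0`.
  have hn : ∀ x : USphere n, 0 < √(n : ℝ) := by
    intro x
    rcases Nat.eq_zero_or_pos n with rfl | hn
    · have h1 := mem_sphere_zero_iff_norm.1 x.2
      rw [Subsingleton.elim (x : EuclideanSpace ℝ (Fin 0)) 0, norm_zero] at h1
      exact absurd h1 zero_ne_one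
    · exact Real.sqrt_pos.2 (by exact_mod_cast hn)
  have hnorm : ∀ x : USphere n, ‖√(n : ℝ) • (x : EuclideanSpace ℝ (Fin n))‖ = √n := by
    intro x
    rw [norm_smul, mem_sphere_zero_iff_norm.1 x.2, mul_one,
      Real.norm_of_nonneg (Real.sqrt_nonneg _)]
  have hlow : ∀ x : USphere n, a * √n ≤ ‖coordApply φ (x : EuclideanSpace ℝ (Fin n))‖ := by
    intro x
    have := h.le_norm_coordMap ha h0 (√(n : ℝ) • (x : EuclideanSpace ℝ (Fin n)))
    rwa [hnorm] at this
  have hne : ∀ x : USphere n, coordApply φ (x : EuclideanSpace ℝ (Fin n)) ≠ 0 := by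
    intro x
    exact norm_pos_iff.1 (lt_of_lt_of_le (mul_pos ha (hn x)) (hlow x))
  let ψ : USphere n → USphere n := fun x =>
    ⟨‖coordApply φ (x : EuclideanSpace ℝ (Fin n))‖⁻¹ • coordApply φ (x : EuclideanSpace ℝ (Fin n)),
      by
        rw [mem_sphere_zero_iff_norm, norm_smul, norm_inv, norm_norm,
          inv_mul_cancel₀ (norm_ne_zero_iff.2 (hne x))]⟩
  have hLip : LipschitzWith (2 * b / a).toNNReal ψ := by
    refine LipschitzWith.of_dist_le_mul fun x y => ?_
    rw [Real.coe_toNNReal _ (by positivity), Subtype.dist_eq, Subtype.dist_eq, dist_eq_norm,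
      dist_eq_norm]
    refine (SlopesIn.norm_normalize_sub_le (hne x) (hne y)).trans ?_
    have h1 := h.norm_coordMap_sub_le ha hb (√(n : ℝ) • (x : EuclideanSpace ℝ (Fin n)))
      (√(n : ℝ) • (y : EuclideanSpace ℝ (Fin n)))
    rw [← smul_sub, norm_smul, Real.norm_of_nonneg (Real.sqrt_nonneg _)] at h1
    have hx := hn x
    have h2 : ‖coordApply φ (x : EuclideanSpace ℝ (Fin n))‖⁻¹ ≤ (a * √n)⁻¹ :=
      inv_anti₀ (by positivity) (hlow x)
    calc _ ≤ 2 * (a * √n)⁻¹ * (b * (√n * ‖(x : EuclideanSpace ℝ (Fin n)) - y‖)) := by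
          gcongr
          exact h1
      _ = _ := by field_simp
  have hAnti : AntilipschitzWith (b / a * (1 + b ^ 2 / a ^ 2)).toNNReal ψ := by
    refine AntilipschitzWith.of_le_mul_dist fun x y => ?_
    rw [Real.coe_toNNReal _ (by positivity), Subtype.dist_eq, Subtype.dist_eq, dist_eq_norm,
      dist_eq_norm]
    have hx := hn x
    have h1 := h.norm_sub_le ha hb h0 hx (hnorm x) (hnorm y)
    rw [← smul_sub, norm_smul, Real.norm_of_nonneg (Real.sqrt_nonneg _)] at h1
    refine le_of_mul_le_mul_left (h1.trans_eq ?_) hx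
    simp only [ψ, coordApply_eq]
    ring
  refine ⟨ψ, fun x => ⟨hne x, rfl⟩, hLip.continuous, fun x => ?_, ⟨hAnti.injective, fun y => ?_⟩,
    hLip.weaken (le_max_left _ _), fun x y => (hAnti x y).trans ?_⟩
  · have e : coordApply φ (-(x : EuclideanSpace ℝ (Fin n))) = -coordApply φ (x : _) := by
      ext i
      simp [coordApply, hodd]
    ext1
    simp only [ψ, coe_neg_sphere, e, norm_neg, smul_neg]
  · have hy := hn y
    obtain ⟨x, t, ht, hx, hxy⟩ :=
      h.exists_coordMap_eq_smul ha hb h0 hc hy (mem_sphere_zero_iff_norm.1 y.2)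
    refine ⟨⟨(√n)⁻¹ • x, ?_⟩, ?_⟩
    · rw [mem_sphere_zero_iff_norm, norm_smul, hx, norm_inv,
        Real.norm_of_nonneg (Real.sqrt_nonneg _), inv_mul_cancel₀ hy.ne']
    · ext1
      simp only [ψ, coordApply_eq, smul_smul, mul_inv_cancel₀ hy.ne', one_smul, hxy, norm_smul,
        mem_sphere_zero_iff_norm.1 y.2, mul_one, Real.norm_of_nonneg ht.le, inv_mul_cancel₀ ht.ne']
  · gcongr
    exact le_max_right _ _

end CoordMap

/-! ### Great circles are far from vectors with coordinates in a geometric progression -/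

section GreatCircle

lemma abs_eq_or_mul_abs_le_of_mem_geomSet {lam a b : ℝ} (hlam : 1 < lam) (ha : a ∈ geomSet lam)
    (hb : b ∈ geomSet lam) (hab : |a| ≤ |b|) : |a| = |b| ∨ lam * |a| ≤ |b| := by
  have h0 : 0 < lam := by linarith
  rcases ha with rfl | ⟨i, hi⟩
  · right; simp
  · rcases hb with rfl | ⟨j, hj⟩
    · left
      exact le_antisymm hab (by simp)
    · rw [hi, hj] at hab ⊢
      rcases ((zpow_le_zpow_iff_right₀ hlam).1 hab).eq_or_lt with h | h
      · exact Or.inl (by rw [h])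
      · right
        rw [mul_comm, ← zpow_add_one₀ h0.ne']
        exact (zpow_le_zpow_iff_right₀ hlam).2 h

/-- Every nonempty signed partial sum of 3, 4, 5 is a nonzero integer. The entries of size `T` thus
contribute at least `T` in absolute value, and the remaining ones at most `9 T / 1000`. -/
lemma half_le_abs_three_four_five {T a b c : ℝ} (hT : 0 ≤ T)
    (ha : a = T ∨ a = -T ∨ |a| ≤ T / 1000) (hb : b = T ∨ b = -T ∨ |b| ≤ T / 1000)
    (hc : c = T ∨ c = -T ∨ |c| ≤ T / 1000) (h : |a| = T ∨ |b| = T ∨ |c| = T) :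
    T / 2 ≤ |3 * a + 4 * b - 5 * c| := by
  rw [le_abs]
  rcases hT.eq_or_lt with rfl | hT
  · simp only [neg_zero, zero_div, abs_nonpos_iff, or_self] at ha hb hc
    left; simp [ha, hb, hc]
  have key : ∀ x : ℝ, |x| ≤ T / 1000 → -(T / 1000) ≤ x ∧ x ≤ T / 1000 := fun x hx => abs_le.1 hx
  rcases ha with ha | ha | ha <;> rcases hb with hb | hb | hb <;> rcases hc with hc | hc | hc <;>
    (try have ha' := key _ ha) <;> (try have hb' := key _ hb) <;> (try have hc' := key _ hc) <;>
    first
    | left; linarith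
    | right; linarith
    | rcases h with h | h | h <;> linarith

/-- A quantitative form of the fact that `3 a + 4 b = 5 c` has no nontrivial solutions in the
geometric progression `{0} ∪ {± 1000 ^ m}`. -/
lemma half_abs_le_of_mem_geomSet {a b c : ℝ} (ha : a ∈ geomSet 1000) (hb : b ∈ geomSet 1000)
    (hc : c ∈ geomSet 1000) : |a| / 2 ≤ |3 * a + 4 * b - 5 * c| := by
  -- `t` is whichever of `a`, `b`, `c` is largest in absolute value; the others match it up to sign
  -- or are at least 1000 times smaller.
  have key : ∀ t ∈ geomSet (1000 : ℝ), |a| ≤ |t| → |b| ≤ |t| → |c| ≤ |t| →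
      (|a| = |t| ∨ |b| = |t| ∨ |c| = |t|) → |a| / 2 ≤ |3 * a + 4 * b - 5 * c| := by
    intro t ht hat hbt hct h
    have hx : ∀ x ∈ geomSet (1000 : ℝ), |x| ≤ |t| → x = |t| ∨ x = -|t| ∨ |x| ≤ |t| / 1000 := by
      intro x hx hxt
      rcases abs_eq_or_mul_abs_le_of_mem_geomSet (by norm_num) hx ht hxt with h | h
      · rcases abs_eq (abs_nonneg t) |>.1 h with h | h
        · exact Or.inl h
        · exact Or.inr (Or.inl h)
      · right; right; linarith
    have := half_le_abs_three_four_five (abs_nonneg t) (hx a ha hat) (hx b hb hbt) (hx c hc hct) h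
    linarith
  rcases le_total |a| |b| with hab | hab
  · rcases le_total |b| |c| with hbc | hbc
    · exact key c hc (hab.trans hbc) hbc le_rfl (by simp)
    · exact key b hb hab le_rfl hbc (by simp)
  · rcases le_total |a| |c| with hac | hac
    · exact key c hc hac (hab.trans hac) le_rfl (by simp)
    · exact key a ha le_rfl hab hac (by simp)

/-- The vectors with coordinates in the geometric progression `{0} ∪ {± lam ^ m}`. -/
def geomVectors (lam : ℝ) (n : ℕ) : Set (EuclideanSpace ℝ (Fin n)) := {x | ∀ i, x i ∈ geomSet lam}

variable {n : ℕ}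

lemma half_norm_le_of_mem_geomVectors {a b c : EuclideanSpace ℝ (Fin n)}
    (ha : a ∈ geomVectors 1000 n) (hb : b ∈ geomVectors 1000 n) (hc : c ∈ geomVectors 1000 n) :
    ‖a‖ ≤ 2 * ‖(3 : ℝ) • a + (4 : ℝ) • b - (5 : ℝ) • c‖ := by
  refine norm_le_mul_norm_of_abs_le zero_le_two fun i => ?_
  have := half_abs_le_of_mem_geomSet (ha i) (hb i) (hc i)
  simp only [PiLp.sub_apply, PiLp.add_apply, PiLp.smul_apply, smul_eq_mul]
  linarith

/-- No great circle, scaled to radius `r`, is `r / 30`-close to the vectors with coordinates in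
the geometric progression with ratio `1000`. -/
theorem not_forall_norm_smul_sub_le {V : Submodule ℝ (EuclideanSpace ℝ (Fin n))}
    (hV : Module.finrank ℝ V = 2) {r : ℝ} (hr : 0 < r)
    (h : ∀ p ∈ V, ‖p‖ = 1 → ∃ a ∈ geomVectors 1000 n, ‖r • p - a‖ ≤ r / 30) : False := by
  set B := (stdOrthonormalBasis ℝ V).reindex (finCongr hV)
  set u : EuclideanSpace ℝ (Fin n) := ((B 0 : V) : EuclideanSpace ℝ (Fin n))
  set v : EuclideanSpace ℝ (Fin n) := ((B 1 : V) : EuclideanSpace ℝ (Fin n))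
  have hu : ‖u‖ = 1 := B.orthonormal.1 0
  have hv : ‖v‖ = 1 := B.orthonormal.1 1
  have huv : inner ℝ u v = 0 := B.orthonormal.2 (show (0 : Fin 2) ≠ 1 by decide)
  -- The Pythagorean triple makes `w` a unit vector satisfying an integer relation with `u` and `v`.
  set w := (3 / 5 : ℝ) • u + (4 / 5 : ℝ) • v with hw_def
  have hwV : w ∈ V := V.add_mem (V.smul_mem _ (B 0).2) (V.smul_mem _ (B 1).2)
  have hw : ‖w‖ = 1 := by
    have : ‖w‖ ^ 2 = 1 := by
      rw [hw_def, norm_add_sq_real, norm_smul, norm_smul, inner_smul_left, inner_smul_right, huv,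
        hu, hv]
      norm_num
    exact (pow_eq_one_iff_of_nonneg (norm_nonneg w) two_ne_zero).1 this
  obtain ⟨a, ha, hau⟩ := h u (B 0).2 hu
  obtain ⟨b, hb, hbv⟩ := h v (B 1).2 hv
  obtain ⟨c, hc, hcw⟩ := h w hwV hw
  have h1 := half_norm_le_of_mem_geomVectors ha hb hc
  have h2 : (3 : ℝ) • a + (4 : ℝ) • b - (5 : ℝ) • c =
      (5 : ℝ) • (r • w - c) - (3 : ℝ) • (r • u - a) - (4 : ℝ) • (r • v - b) := by
    rw [hw_def]; module
  have h3 : ‖(3 : ℝ) • a + (4 : ℝ) • b - (5 : ℝ) • c‖ ≤ 12 * (r / 30) := by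
    rw [h2]
    refine (norm_sub_le _ _).trans ?_
    refine (add_le_add_left (norm_sub_le _ _) _).trans ?_
    rw [norm_smul, norm_smul, norm_smul]
    norm_num
    linarith
  -- The contradiction: `‖a‖ ≥ 29 r / 30` here, while `h1` and `h3` give `‖a‖ ≤ 24 r / 30`.
  have h4 : r ≤ ‖a‖ + r / 30 := by
    have e : r • u = a + (r • u - a) := by abel
    have := norm_add_le a (r • u - a)
    rw [← e, norm_smul, hu, mul_one, Real.norm_of_nonneg hr.le] at this
    linarith
  linarith

end GreatCircle

/-! ### The images of random subspheres -/

section Staircase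
open ProbabilityTheory

variable {n : ℕ} {φ : ℝ → ℝ}

lemma norm_coordMap_sq (x : EuclideanSpace ℝ (Fin n)) :
    ‖coordMap φ x‖ ^ 2 = ∑ i, φ (x i) ^ 2 := (sum_sq_eq_norm_sq _).symm

/-- The coordinatewise rounding of `x` is a competitor. The right side is a sum to which the
Chernoff bound applies. -/
lemma infDist_coordMap_sq_le {lam : ℝ} (hlam : 1 < lam) (x : EuclideanSpace ℝ (Fin n)) :
    Metric.infDist (coordMap φ x) (geomVectors lam n) ^ 2 ≤
      ∑ i, (φ (x i) - stairRound lam (x i)) ^ 2 := by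
  have hmem : coordMap (stairRound lam) x ∈ geomVectors lam n :=
    fun i => stairRound_mem_geomSet hlam _
  have h1 := Metric.infDist_le_dist_of_mem (x := coordMap φ x) hmem
  rw [dist_eq_norm] at h1
  refine (pow_le_pow_left₀ Metric.infDist_nonneg h1 2).trans_eq ?_
  exact (sum_sq_eq_norm_sq _).symm

/-- A great circle in the closed thickening is impossible if the coordinatewise map of the
subspace has nearly constant norm and is close to the geometric progression. -/
lemma not_containsGreatCircle {ψ : USphere n → USphere n} (hψ : IsNormalizedCoordMap φ ψ)
    (hn : 0 < n) {M : ℝ} (hM : 0 < M) {X : Submodule ℝ (EuclideanSpace ℝ (Fin n))}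
    (hX : ∀ x ∈ X, ‖x‖ = 1 →
      Metric.infDist (coordMap φ (√n • x)) (geomVectors 1000 n) ≤ M / 200 * √n ∧
      |‖coordMap φ (√n • x)‖ - M * √n| ≤ M / 200 * √n) :
    ¬ ContainsGreatCircle (Metric.cthickening (1 / 200) (ψ '' linearSubsphere X)) := by
  rintro ⟨V, hV, hsub⟩
  have hsn : 0 < √(n : ℝ) := Real.sqrt_pos.2 (by exact_mod_cast hn)
  refine not_forall_norm_smul_sub_le hV (mul_pos hM hsn) fun p hp hp1 => ?_
  have h1 := hsub (show (⟨p, mem_sphere_zero_iff_norm.2 hp1⟩ : USphere n) ∈ linearSubsphere V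
    from hp)
  -- Enlarging to an open thickening yields an actual nearby point. In units of `M √n` the errors
  -- are `1/100 + 1/200 + 1/100 = 1/40`, below the permitted `1/30`.
  have h2 := Metric.cthickening_subset_thickening' (δ₁ := 1 / 200) (δ₂ := 1 / 100) (by norm_num)
    (by norm_num) _ h1
  obtain ⟨_, ⟨x, hx, rfl⟩, hdist⟩ := Metric.mem_thickening_iff.1 h2
  rw [Subtype.dist_eq, dist_eq_norm] at hdist
  obtain ⟨hD, hN⟩ := hX x hx (mem_sphere_zero_iff_norm.1 x.2)
  obtain ⟨hne, hψx⟩ := hψ x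
  rw [coordApply_eq] at hne hψx
  set u := coordMap φ (√(n : ℝ) • (x : EuclideanSpace ℝ (Fin n)))
  have hnonempty : (geomVectors 1000 n).Nonempty := ⟨0, fun i => Or.inl rfl⟩
  obtain ⟨a, ha, hau⟩ := (Metric.infDist_lt_iff hnonempty).1
    (lt_of_le_of_lt hD (show M / 200 * √n < M / 100 * √n by gcongr; norm_num))
  rw [dist_eq_norm] at hau
  refine ⟨a, ha, ?_⟩
  have hupos : 0 < ‖u‖ := norm_pos_iff.2 hne
  have h3 : ‖(M * √n) • (ψ x : EuclideanSpace ℝ (Fin n)) - u‖ = |‖u‖ - M * √n| := by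
    have e : (M * √n) • (ψ x : EuclideanSpace ℝ (Fin n)) - u =
        ((M * √n - ‖u‖) * ‖u‖⁻¹) • u := by
      rw [hψx, smul_smul, sub_mul, mul_inv_cancel₀ hupos.ne', sub_smul, one_smul]
    rw [e, norm_smul, norm_mul, norm_inv, norm_norm, mul_assoc, inv_mul_cancel₀ hupos.ne',
      mul_one, Real.norm_eq_abs, abs_sub_comm]
  have h4 : ‖(M * √n) • p - (M * √n) • (ψ x : EuclideanSpace ℝ (Fin n))‖ ≤
      M * √n * (1 / 100) := by
    rw [← smul_sub, norm_smul, Real.norm_of_nonneg (by positivity)]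
    gcongr
  have e : (M * √n) • p - a = ((M * √n) • p - (M * √n) • (ψ x : EuclideanSpace ℝ (Fin n))) +
      ((M * √n) • (ψ x : EuclideanSpace ℝ (Fin n)) - u) + (u - a) := by abel
  rw [e]
  refine (norm_add₃_le).trans ?_
  rw [h3]
  have := mul_pos hM hsn
  linarith

lemma lipschitzWith_coordMap {a b : ℝ} (h : SlopesIn φ a b) (ha : 0 < a) (hb : 0 < b) (n : ℕ) :
    LipschitzWith b.toNNReal (coordMap φ : EuclideanSpace ℝ (Fin n) → _) := by
  refine LipschitzWith.of_dist_le_mul fun x y => ?_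
  rw [Real.coe_toNNReal _ hb.le, dist_eq_norm, dist_eq_norm]
  exact h.norm_coordMap_sub_le ha hb x y

/-- With high probability, the norm of the coordinatewise map is nearly constant on a random
subspace of small proportional dimension, and its values are close to the geometric
progression. -/
lemma exists_tendsto_haarO_staircase {a b lam : ℝ} (h : SlopesIn φ a b) (ha : 0 < a) (hb : 0 < b)
    (hlam : 1 < lam) (hφm : Measurable φ) {C : ℝ} (hφC : ∀ x, φ x ^ 2 ≤ C * x ^ 2)
    (hrC : ∀ x, (φ x - stairRound lam x) ^ 2 ≤ C * x ^ 2) {M η : ℝ} (hM : 0 < M)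
    (hMφ : ∫ x, φ x ^ 2 ∂gaussianReal 0 1 = M ^ 2) (hη : 0 < η) (hηM : η < M)
    (hηr : ∫ x, (φ x - stairRound lam x) ^ 2 ∂gaussianReal 0 1 < (η / 2) ^ 2) :
    ∃ α₀ : ℝ, 0 < α₀ ∧ ∀ α, 0 < α → α ≤ α₀ →
      Tendsto (fun n : ℕ => haarO n {U | ¬ ∀ x ∈ rotatedSubspace (⌊α * n⌋₊ + 1) U, ‖x‖ = 1 →
        Metric.infDist (coordMap φ (√n • x)) (geomVectors lam n) ≤ η * √n ∧
        |‖coordMap φ (√n • x)‖ - M * √n| ≤ η * √n}) atTop (𝓝 0) := by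
  have hsqrt : ∀ n : ℕ, √(n : ℝ) ^ 2 = n := fun n => Real.sq_sqrt (by positivity)
  have hL := lipschitzWith_coordMap h ha hb
  have hm2 : Measurable fun x => φ x ^ 2 := hφm.pow_const 2
  have hmr : Measurable fun x => (φ x - stairRound lam x) ^ 2 :=
    (hφm.sub (measurable_stairRound lam)).pow_const 2
  have hLnorm : ∀ n, LipschitzWith b.toNNReal
      (fun x : EuclideanSpace ℝ (Fin n) => ‖coordMap φ x‖) := fun n => by
    simpa using! lipschitzWith_one_norm.comp (hL n)
  have hLdist : ∀ n, LipschitzWith b.toNNReal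
      (fun x : EuclideanSpace ℝ (Fin n) => Metric.infDist (coordMap φ x) (geomVectors lam n)) :=
    fun n => by simpa using! (Metric.lipschitz_infDist_pt (geomVectors lam n)).comp (hL n)
  obtain ⟨c₁, hc₁, h₁⟩ := exists_stdGaussian_sum_le_exp_neg (m := (η / 2) ^ 2) hmr
    (fun x => by rw [abs_of_nonneg (sq_nonneg _)]; exact hrC x) hηr
  obtain ⟨c₂, hc₂, h₂⟩ := exists_stdGaussian_sum_le_exp_neg (m := (M + η / 2) ^ 2) hm2
    (fun x => by rw [abs_of_nonneg (sq_nonneg _)]; exact hφC x) (by rw [hMφ]; nlinarith)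
  obtain ⟨c₃, hc₃, h₃⟩ := exists_stdGaussian_sum_le_exp_neg (f := fun x => -φ x ^ 2)
    (m := -(M - η / 2) ^ 2) hm2.neg
    (fun x => by rw [abs_neg, abs_of_nonneg (sq_nonneg _)]; exact hφC x)
    (by rw [integral_neg, hMφ]; nlinarith)
  -- The Gaussian tails use a margin `η / 2`; the other half pays for uniformity over the subsphere.
  -- The lower bound on the norm is obtained as an upper bound for its negative.
  obtain ⟨α₁, hα₁, H₁⟩ := exists_tendsto_haarO_rotatedSubspace hLdist (m := η / 2) (m' := η)
    (by linarith) hc₁ fun n => by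
      refine (measure_mono fun g hg => ?_).trans (h₁ n)
      have hg : η / 2 * √n < _ := hg
      have := pow_le_pow_left₀ (by positivity) hg.le 2
      rw [mul_pow, hsqrt] at this
      exact this.trans (infDist_coordMap_sq_le hlam g)
  obtain ⟨α₂, hα₂, H₂⟩ := exists_tendsto_haarO_rotatedSubspace hLnorm (m := M + η / 2)
    (m' := M + η) (by linarith) hc₂ fun n => by
      refine (measure_mono fun g hg => ?_).trans (h₂ n)
      have hg : (M + η / 2) * √n < _ := hg
      have := pow_le_pow_left₀ (by positivity) hg.le 2
      rwa [mul_pow, hsqrt, norm_coordMap_sq] at this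
  obtain ⟨α₃, hα₃, H₃⟩ := exists_tendsto_haarO_rotatedSubspace (fun n => (hLnorm n).neg)
    (m := -(M - η / 2)) (m' := -(M - η)) (by linarith) hc₃ fun n => by
      refine (measure_mono fun g hg => ?_).trans (h₃ n)
      have hg : -(M - η / 2) * √n < -‖coordMap φ g‖ := hg
      have := pow_le_pow_left₀ (norm_nonneg _)
        (show ‖coordMap φ g‖ ≤ (M - η / 2) * √n by linarith) 2
      rw [mul_pow, hsqrt, norm_coordMap_sq] at this
      rw [Set.mem_ofPred_eq, Finset.sum_neg_distrib]
      linarith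
  refine ⟨min α₁ (min α₂ α₃), by positivity, fun α hα hle => ?_⟩
  have hsum := ((H₁ α hα (hle.trans (min_le_left _ _))).add
    (H₂ α hα (hle.trans ((min_le_right _ _).trans (min_le_left _ _))))).add
    (H₃ α hα (hle.trans ((min_le_right _ _).trans (min_le_right _ _))))
  rw [add_zero, add_zero] at hsum
  refine tendsto_of_tendsto_of_tendsto_of_le_of_le tendsto_const_nhds hsum (fun _ => zero_le)
    fun n => ?_
  refine (measure_mono fun U hU => ?_).trans ((measure_union_le _ _).trans
    (add_le_add_left (measure_union_le _ _) _))
  simp only [Set.mem_ofPred_eq, not_forall] at hU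
  obtain ⟨x, hx, hx1, hcon⟩ := hU
  by_contra hout
  simp only [Set.mem_union, Set.mem_ofPred_eq, not_or, not_exists, not_and, not_lt] at hout
  obtain ⟨⟨o₁, o₂⟩, o₃⟩ := hout
  have p₁ := o₁ x hx hx1
  have p₂ := o₂ x hx hx1
  have p₃ := o₃ x hx hx1
  simp only [Pi.neg_apply] at p₃
  exact hcon ⟨p₁, abs_le.2 ⟨by linarith, by linarith⟩⟩

/-- There is a staircase function with ratio `1000` which is, in quadratic mean, much closer to
its rounding to the geometric progression than its size. -/
lemma exists_staircase_near_geomSet :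
    ∃ (k : ℕ) (φ : ℝ → ℝ) (a b M : ℝ), 2 ≤ k ∧ IsStaircase 1000 k φ ∧ 0 < a ∧ 0 < b ∧
      SlopesIn φ a b ∧ 0 < M ∧ ∫ x, φ x ^ 2 ∂gaussianReal 0 1 = M ^ 2 ∧
      ∫ x, (φ x - stairRound 1000 x) ^ 2 ∂gaussianReal 0 1 < (M / 200 / 2) ^ 2 := by
  have hlam : (1 : ℝ) < 1000 := by norm_num
  have hex : ∀ k : ℕ, ∃ φ : ℝ → ℝ, 2 ≤ k → IsStaircase 1000 k φ ∧ ∃ a b : ℝ, 0 < a ∧ 0 < b ∧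
      SlopesIn φ a b := by
    intro k
    by_cases hk : 2 ≤ k
    · obtain ⟨φ, hφ⟩ := exists_isStaircase hlam hk
      exact ⟨φ, fun _ => hφ⟩
    · exact ⟨0, fun h => absurd h hk⟩
  choose φ hφ using hex
  have hlim := tendsto_integral_staircase_sub_stairRound_sq hlam fun k hk => (hφ k hk).1
  -- Since `|φ x| ≥ |x| / 1000` for every `k ≥ 2`, `M ≥ 1 / 1000` independently of `k`; so a fixed
  -- target for the mean square error suffices.
  obtain ⟨k, hk1, hk⟩ := ((hlim.eventually_lt_const
    (show (0 : ℝ) < (1 / 1000 / 200 / 2) ^ 2 by norm_num)).and (eventually_ge_atTop 2)).exists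
  obtain ⟨hst, a, b, ha, hb, hab⟩ := hφ k hk
  set I := ∫ x, φ k x ^ 2 ∂gaussianReal 0 1 with hI_def
  have hI : (1 / 1000 : ℝ) ^ 2 ≤ I := by
    have hint : Integrable (fun x => φ k x ^ 2) (gaussianReal 0 1) := by
      refine integrable_gaussianReal_of_abs_le (hst.continuous.measurable.pow_const 2)
        (C := (1000 ^ 2) ^ 2) fun x => ?_
      rw [abs_of_nonneg (sq_nonneg _), ← sq_abs, ← sq_abs x, ← mul_pow]
      exact pow_le_pow_left₀ (abs_nonneg _) (hst.abs_apply_le hlam hk x) 2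
    have hint2 : Integrable (fun x : ℝ => (1 / 1000 : ℝ) ^ 2 * x ^ 2) (gaussianReal 0 1) :=
      integrable_gaussianReal_of_abs_le ((measurable_id.pow_const 2).const_mul _)
        (C := (1 / 1000) ^ 2) fun x => by rw [abs_of_nonneg (by positivity)]
    have := integral_mono hint2 hint fun x => by
      have h1 := pow_le_pow_left₀ (by positivity) (hst.div_le_abs_apply hlam hk x) 2
      rw [div_pow, sq_abs, sq_abs] at h1
      simp only
      linarith
    rwa [integral_const_mul, integral_sq_gaussianReal, mul_one] at this
  have hM : 1 / 1000 ≤ √I := Real.le_sqrt_of_sq_le hI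
  refine ⟨k, φ k, a, b, √I, hk, hst, ha, hb, hab, by linarith,
    (Real.sq_sqrt (le_trans (by positivity) hI)).symm, hk1.trans_le ?_⟩
  gcongr

end Staircase

end

theorem theorem2 :
    ∃ (α ε lam : ℝ) (k : ℕ) (L : ℝ≥0) (φ : ℝ → ℝ) (ψ : (n : ℕ) → USphere n → USphere n),
      0 < α ∧ α < 1 ∧ 0 < ε ∧ 1 < lam ∧ 2 ≤ k ∧ IsStaircase lam k φ ∧
      (∀ n : ℕ,
        IsNormalizedCoordMap φ (ψ n) ∧
        Continuous (ψ n) ∧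
        (∀ x : USphere n, ψ n (-x) = -ψ n x) ∧
        Function.Bijective (ψ n) ∧ LipschitzWith L (ψ n) ∧ AntilipschitzWith L (ψ n)) ∧
      Tendsto
        (fun n : ℕ => randomSubspaceProb n (⌊α * n⌋₊ + 1) fun V =>
          ¬ ContainsGreatCircle (Metric.cthickening ε (ψ n '' linearSubsphere V)))
        atTop (𝓝 1) ∧
      Tendsto
        (fun n : ℕ => randomSubspaceProb n (⌊α * n⌋₊ + 1) fun V =>
          ContainsGreatCircle (Metric.cthickening ε (ψ n '' linearSubsphere V)))
        atTop (𝓝 0) := by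
  obtain ⟨k, φ, a, b, M, hk, hst, ha, hb, hab, hM, hMφ, hr⟩ := exists_staircase_near_geomSet
  have hlam : (1 : ℝ) < 1000 := by norm_num
  obtain ⟨L, hL⟩ := exists_isNormalizedCoordMap hab ha hb hst.continuous hst.odd
  choose ψ hψ using hL
  obtain ⟨α₀, hα₀, hlim⟩ := exists_tendsto_haarO_staircase hab ha hb hlam
    hst.continuous.measurable (C := (1000 ^ 2) ^ 2)
    (fun x => by
      rw [← sq_abs, ← sq_abs x, ← mul_pow]
      exact pow_le_pow_left₀ (abs_nonneg _) (hst.abs_apply_le hlam hk x) 2)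
    (fun x => by
      rw [← sq_abs, ← sq_abs x, ← mul_pow]
      exact pow_le_pow_left₀ (abs_nonneg _) (hst.abs_sub_stairRound_le hlam hk x) 2)
    hM hMφ (show 0 < M / 200 by positivity) (by linarith) hr
  have hα : 0 < min α₀ (1 / 2) := by positivity
  have hzero : Tendsto
      (fun n : ℕ => randomSubspaceProb n (⌊min α₀ (1 / 2) * n⌋₊ + 1) fun V =>
        ContainsGreatCircle (Metric.cthickening (1 / 200) (ψ n '' linearSubsphere V)))
      atTop (𝓝 0) := by
    refine tendsto_of_tendsto_of_tendsto_of_le_of_le' tendsto_const_nhds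
      (hlim _ hα (min_le_left _ _)) (Eventually.of_forall fun _ => zero_le) ?_
    filter_upwards [eventually_gt_atTop 0] with n hn
    refine measure_mono fun U hU hgood => ?_
    exact not_containsGreatCircle (hψ n).1 hn hM hgood hU
  refine ⟨min α₀ (1 / 2), 1 / 200, 1000, k, L, φ, ψ, hα,
    (min_le_right _ _).trans_lt (by norm_num), by norm_num, hlam, hk, hst, hψ, ?_, hzero⟩
  -- Measurability of the event is not needed: subadditivity of the outer measure bounds the
  -- probability of the complement below by one minus that of the event.
  have hsub : Tendsto (fun n : ℕ => 1 -
      randomSubspaceProb n (⌊min α₀ (1 / 2) * n⌋₊ + 1) fun V =>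
        ContainsGreatCircle (Metric.cthickening (1 / 200) (ψ n '' linearSubsphere V)))
      atTop (𝓝 1) := by
    simpa using ENNReal.Tendsto.sub tendsto_const_nhds hzero (Or.inl ENNReal.one_ne_top)
  refine tendsto_of_tendsto_of_tendsto_of_le_of_le hsub tendsto_const_nhds (fun n => ?_)
    fun n => prob_le_one
  rw [tsub_le_iff_left, ← measure_univ (μ := haarO n)]
  refine (measure_mono fun U _ => ?_).trans (measure_union_le _ _)
  exact em _
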